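/- **Theorem 2.1.** Let $\alpha>0$ and $\xi>-1$ be real numbers, put $q=e^{-2\pi\alpha}$ and $x=e^{-2\pi(1+\xi)\alpha}$, and let $(x;q)_\infty=\prod_{n=0}^\infty(1-xq^n)$, which is a convergent product with positive value. Then $$\log(x;q)_\infty=-\frac{\pi}{12\alpha}+\log\frac{\sqrt{2\pi}}{\Gamma(\xi+1)}+\frac{\pi}{12}\alpha-\Bigl(\xi+\frac12\Bigr)\log\frac{1-e^{-2\pi\xi\alpha}}{\xi}+\int_0^\xi\Bigl(\frac{2\pi\alpha t}{e^{2\pi\alpha t}-1}-1\Bigr)dt+M(\alpha,\xi),$$ where $$M(\alpha,\xi)=-\sum_{n=1}^\infty\frac{\cos 2n\pi\xi}{n(e^{2n\pi/\alpha}-1)}-\frac2\pi\,\mathcal{PV}\!\int_0^\infty\sum_{n=1}^\infty\frac{\sin 2n\xi\pi t}{n(e^{2n\pi t/\alpha}-1)}\,\frac{dt}{1-t^2}.$$ Here the quotient $\frac{1-e^{-2\pi\xi\alpha}}{\xi}$ is given its limit value $2\pi\alpha$ when $\xi=0$, and the integrand $\frac{2\pi\alpha t}{e^{2\pi\alpha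 t}-1}-1$ its limit value $0$ at $t=0$. Both series converge (the second one for every $t>0$). The Cauchy principal value is $$\mathcal{PV}\!\int_0^\infty f(t)\,dt=\lim_{\epsilon\to0^+}\Bigl(\int_0^{1-\epsilon}f(t)\,dt+\int_{1+\epsilon}^\infty f(t)\,dt\Bigr),$$ for $f$ continuous on $(0,1)\cup(1,\infty)$ and integrable over $(0,1-\epsilon)$ and $(1+\epsilon,\infty)$ for every $\epsilon>0$; the integrand in $M(\alpha,\xi)$ is such a function, and the limit exists for it. -/

import Mathlib

open Filter Topology MeasureTheory

/-- The infinite product `(x; q)_∞ = ∏_{n ≥ 0} (1 - x q ^ n)`. -/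
noncomputable def qPochhammerInf {R : Type*} [CommRing R] [TopologicalSpace R] (x q : R) : R :=
  ∏' n : ℕ, (1 - x * q ^ n)

/-- The symmetric truncation `∫_0^{1-ε} f + ∫_{1+ε}^∞ f` around the singular point `t = 1`. -/
noncomputable def truncatedIntegral (f : ℝ → ℝ) (ε : ℝ) : ℝ :=
  (∫ t in Set.Ioo 0 (1 - ε), f t) + ∫ t in Set.Ioi (1 + ε), f t

/-- The Cauchy principal value of `∫_0^∞ f(t) dt`, with singular point `t = 1`, exists and is `I`:
`f` is continuous on `(0, 1) ∪ (1, ∞)`, integrable over `(0, 1 - ε)` and over `(1 + ε, ∞)` for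
every `ε > 0`, and the sum of the two integrals tends to `I` as `ε → 0⁺`. -/
structure HasCauchyPV (f : ℝ → ℝ) (I : ℝ) : Prop where
  continuousOn : ContinuousOn f (Set.Ioo 0 1 ∪ Set.Ioi 1)
  integrableOn_left : ∀ ε : ℝ, 0 < ε → IntegrableOn f (Set.Ioo 0 (1 - ε))
  integrableOn_right : ∀ ε : ℝ, 0 < ε → IntegrableOn f (Set.Ioi (1 + ε))
  tendsto : Tendsto (truncatedIntegral f) (𝓝[>] 0) (𝓝 I)

/-- The Cauchy principal value of `∫_0^∞ f(t) dt` with singular point `t = 1`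
(meaningful when `HasCauchyPV f I` holds for some `I`, which is then this number). -/
noncomputable def cauchyPV (f : ℝ → ℝ) : ℝ :=
  limUnder (𝓝[>] 0) (truncatedIntegral f)

/-- `cos (2nπξ) / (n (e^{2nπ/α} - 1))`; the series runs over `n ≥ 1`. -/
noncomputable def cosTerm (α ξ : ℝ) (n : ℕ+) : ℝ :=
  Real.cos (2 * n * Real.pi * ξ) / (n * (Real.exp (2 * n * Real.pi / α) - 1))

/-- `sin (2nξπt) / (n (e^{2nπt/α} - 1))`; the series runs over `n ≥ 1`. -/
noncomputable def sinTerm (α ξ t : ℝ) (n : ℕ+) : ℝ :=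
  Real.sin (2 * n * ξ * Real.pi * t) / (n * (Real.exp (2 * n * Real.pi * t / α) - 1))

/-- The integrand of the singular integral. -/
noncomputable def singularIntegrand (α ξ t : ℝ) : ℝ :=
  (∑' n : ℕ+, sinTerm α ξ t n) * (1 / (1 - t ^ 2))

/-- The term `M(α, ξ)`. -/
noncomputable def almostModularTerm (α ξ : ℝ) : ℝ :=
  -(∑' n : ℕ+, cosTerm α ξ n) - 2 / Real.pi * cauchyPV (singularIntegrand α ξ)

/-- The quotient `(1 - e^{-2πξα}) / ξ`, with its limit value `2πα` at `ξ = 0`. -/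
noncomputable def expQuotient (α ξ : ℝ) : ℝ :=
  if ξ = 0 then 2 * Real.pi * α else (1 - Real.exp (-2 * Real.pi * ξ * α)) / ξ

/-- The function `2παt / (e^{2παt} - 1) - 1`, with its limit value `0` at `t = 0`. -/
noncomputable def bernoulliIntegrand (α t : ℝ) : ℝ :=
  if t = 0 then 0 else 2 * Real.pi * α * t / (Real.exp (2 * Real.pi * α * t) - 1) - 1

/-!
Write `L(ξ)` for the logarithm of the product and `ℓ(ξ)` for `logExpQuotient α ξ`. The formula
follows from a uniqueness argument in `ξ`: the difference of its two sides is invariant under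
`ξ ↦ ξ + 1` and tends to `0` as `ξ → ∞` along a class modulo `1`, hence vanishes. The cosine
series is itself invariant, so `defect` collects the remaining terms, and the two facts needed are
`defect_add_one` and `tendsto_defect`.

The link between the singular integral and the elementary terms is the sine transform
`K(ξ) = ∫_0^∞ sin(2πξu) / (e^{2πu/α} - 1) du` (`boseSine`). By the partial fractions of the
cotangent, `4πK = ℓ' + πα` (`hasDerivAt_logExpQuotient`). In the singular integral the factor
`1/(1 - t²)` is written as `1 + t²/(1 - t²)`. The part with `1` integrates to `(π²/6) K(ξ)`; the
part with `t²/(1 - t²)` is treated term by term, with the pole at `t = 1` split off in each term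
(`modePV`), which also shows that the principal value exists
(`truncatedIntegral_of_decomposition`).

*Invariance.* The functional equations of `L` and `Γ` and an integration by parts reduce the
invariance to the claim that `2/π` times the increment of the principal value is the trapezoidal
error `(ℓ(ξ) + ℓ(ξ+1))/2 - ∫_ξ^{ξ+1} ℓ` (`sinePV_add_one_sub_eq`). In the `n`-th term,
`sin(2πn(ξ+1)t) - sin(2πnξt)` vanishes at `t = 1`, so the increment is an ordinary integral;
Fubini's theorem identifies it with `-1/n²` times the `n`-th cosine coefficient of `K'` on
`[ξ, ξ+1]` (`modePV_add_one_sub`). Summing over `n` brings in the Fourier series of the second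
Bernoulli polynomial, which up to scaling and an additive constant is the Peano kernel of the
trapezoidal rule.

*Limit.* The product tends to `1`, Stirling's formula deals with `Γ`, and
`∫_0^∞ 2παt / (e^{2παt} - 1) dt = π/(12α)`. In the principal value, `(π²/6) K(ξ)` tends to
`π²α/24`. In the other part, what is left after splitting off the poles is integrable and
disappears by the Riemann–Lebesgue lemma, and the poles give Dirichlet integrals, hence `-π/2`
times the cosine series (`tendsto_sinePV`).
-/

namespace QPochhammerAsymptotics

open Real Set

variable {α β : ℝ}

/-! ### The Bose–Einstein weight -/

/-- The Bose–Einstein weight `1 / (e^{βu} - 1)`. The series of the theorem involve it with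
`β = 2π/α`, the integral of `bernoulliIntegrand α` with `β = 2πα`. -/
noncomputable def bose (β u : ℝ) : ℝ := 1 / (exp (β * u) - 1)

lemma exp_mul_sub_one_pos (hβ : 0 < β) {u : ℝ} (hu : 0 < u) : 0 < exp (β * u) - 1 := by
  have := Real.add_one_lt_exp (x := β * u) (by positivity)
  have : 0 < β * u := by positivity
  linarith

lemma bose_pos (hβ : 0 < β) {u : ℝ} (hu : 0 < u) : 0 < bose β u :=
  one_div_pos.mpr (exp_mul_sub_one_pos hβ hu)

lemma bose_le (hβ : 0 < β) {u : ℝ} (hu : 0 < u) {k : ℕ} (hk : k ≠ 0) :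
    bose β u ≤ k.factorial / (β * u) ^ k := by
  have hx : 0 < β * u := by positivity
  have h1 := Real.sum_le_exp_of_nonneg hx.le (k + 1)
  rw [Finset.sum_range_succ] at h1
  have h2 : 1 ≤ ∑ i ∈ Finset.range k, (β * u) ^ i / (i.factorial : ℝ) := by
    have := Finset.single_le_sum (f := fun i : ℕ => (β * u) ^ i / (i.factorial : ℝ))
      (fun i _ => by positivity) (Finset.mem_range.mpr (Nat.pos_of_ne_zero hk))
    simpa using this
  have h3 : (β * u) ^ k / (k.factorial : ℝ) ≤ exp (β * u) - 1 := by linarith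
  have h4 : (0 : ℝ) < (β * u) ^ k / (k.factorial : ℝ) := by positivity
  calc bose β u ≤ 1 / ((β * u) ^ k / (k.factorial : ℝ)) := one_div_le_one_div_of_le h4 h3
    _ = _ := one_div_div _ _

lemma continuousOn_bose (hβ : 0 < β) : ContinuousOn (bose β) (Ioi 0) := by
  unfold bose
  refine ContinuousOn.div (by fun_prop) (by fun_prop) fun u hu => ?_
  exact (exp_mul_sub_one_pos hβ hu).ne'

lemma measurable_bose : Measurable (bose β) := by
  unfold bose; fun_prop

lemma exists_mul_bose_le (hβ : 0 < β) :
    ∃ C > 0, ∀ u > 0, u * bose β u ≤ C * (1 + u ^ 2)⁻¹ := by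
  refine ⟨1 / β + 6 / β ^ 3, by positivity, fun u hu => ?_⟩
  have h1 := bose_le hβ hu one_ne_zero
  have h3 := bose_le hβ hu three_ne_zero
  rw [← div_eq_mul_inv, le_div_iff₀ (by positivity)]
  have e1 : u * bose β u ≤ 1 / β := by
    calc u * bose β u ≤ u * (Nat.factorial 1 / (β * u) ^ 1) := by gcongr
      _ = 1 / β := by simp; field_simp
  have e3 : u ^ 3 * bose β u ≤ 6 / β ^ 3 := by
    calc u ^ 3 * bose β u ≤ u ^ 3 * (Nat.factorial 3 / (β * u) ^ 3) := by gcongr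
      _ = 6 / β ^ 3 := by simp [Nat.factorial]; field_simp
  nlinarith

lemma integrableOn_mul_bose_of_le (hβ : 0 < β) {φ : ℝ → ℝ} (hφ : Measurable φ) {A : ℝ}
    (hA : ∀ u > 0, |φ u| ≤ A * u) : IntegrableOn (fun u => φ u * bose β u) (Ioi 0) := by
  obtain ⟨C, hC, h⟩ := exists_mul_bose_le hβ
  refine Integrable.mono' (((integrable_inv_one_add_sq.const_mul C).const_mul |A|).integrableOn)
    (hφ.mul measurable_bose).aestronglyMeasurable ?_
  filter_upwards [ae_restrict_mem measurableSet_Ioi] with u hu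
  have hu : 0 < u := hu
  have := bose_pos hβ hu
  rw [norm_mul, Real.norm_eq_abs, Real.norm_eq_abs, abs_of_pos this]
  calc |φ u| * bose β u ≤ (|A| * u) * bose β u := by
        gcongr
        exact (hA u hu).trans (by gcongr; exact le_abs_self A)
    _ = |A| * (u * bose β u) := by ring
    _ ≤ _ := mul_le_mul_of_nonneg_left (h u hu) (abs_nonneg A)

lemma hasSum_bose (hβ : 0 < β) {u : ℝ} (hu : 0 < u) :
    HasSum (fun k : ℕ => exp (-(β * (k + 1)) * u)) (bose β u) := by
  have h1 : exp (-(β * u)) < 1 := by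
    rw [Real.exp_lt_one_iff]; simp; positivity
  have h := (hasSum_geometric_of_lt_one (exp_pos (-(β * u))).le h1).mul_left (exp (-(β * u)))
  convert! h using 1
  · ext k
    rw [← Real.exp_nat_mul, ← Real.exp_add]
    congr 1
    ring
  · have := exp_mul_sub_one_pos hβ hu
    have h2 : 1 - exp (-(β * u)) ≠ 0 := by linarith
    rw [Real.exp_neg] at h2 ⊢
    unfold bose
    have := exp_pos (β * u)
    field_simp

lemma integral_mul_exp_neg {c : ℝ} (hc : 0 < c) :
    ∫ u in Ioi (0 : ℝ), u * exp (-c * u) = 1 / c ^ 2 := by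
  have := Real.integral_rpow_mul_exp_neg_mul_Ioi (a := 2) (r := c) two_pos hc
  rw [Real.Gamma_two] at this
  norm_num at this
  simpa using this

lemma integrableOn_mul_exp_neg {c : ℝ} (hc : 0 < c) :
    IntegrableOn (fun u => u * exp (-c * u)) (Ioi 0) := by
  by_contra h
  have := integral_mul_exp_neg hc
  rw [integral_undef h] at this
  have : 0 < 1 / c ^ 2 := by positivity
  linarith

lemma summable_one_div_const_mul_sq (β : ℝ) :
    Summable (fun k : ℕ => 1 / (β * (k + 1)) ^ 2) := by
  have := ((summable_nat_add_iff 1).mpr (Real.summable_one_div_nat_pow.mpr one_lt_two)).mul_left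
    (1 / β ^ 2)
  refine this.congr fun k => ?_
  push_cast
  rw [mul_pow, one_div_mul_one_div]

/-- The weight may be expanded into exponentials under the integral sign against any function that
vanishes linearly at `0`. -/
lemma hasSum_integral_mul_bose (hβ : 0 < β) {φ : ℝ → ℝ} (hφ : Measurable φ) {A : ℝ}
    (hA : ∀ u > 0, |φ u| ≤ A * u) :
    HasSum (fun k : ℕ => ∫ u in Ioi (0 : ℝ), φ u * exp (-(β * (k + 1)) * u))
      (∫ u in Ioi (0 : ℝ), φ u * bose β u) := by
  have hb : ∀ k : ℕ, ∀ u > 0, ‖φ u * exp (-(β * (k + 1)) * u)‖ ≤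
      A * (u * exp (-(β * (k + 1)) * u)) := by
    intro k u hu
    rw [norm_mul, Real.norm_eq_abs, Real.norm_eq_abs, abs_of_pos (exp_pos _), ← mul_assoc]
    gcongr
    exact hA u hu
  have hi : ∀ k : ℕ, IntegrableOn (fun u => A * (u * exp (-(β * (k + 1)) * u))) (Ioi 0) :=
    fun k => (integrableOn_mul_exp_neg (by positivity)).const_mul A
  have hi' : ∀ k : ℕ, IntegrableOn (fun u => φ u * exp (-(β * (k + 1)) * u)) (Ioi 0) := by
    intro k
    refine Integrable.mono' (hi k) (by fun_prop) ?_
    filter_upwards [ae_restrict_mem measurableSet_Ioi] with u hu using hb k u hu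
  have key := hasSum_integral_of_summable_integral_norm hi' ?_
  · convert! key using 1
    refine setIntegral_congr_fun measurableSet_Ioi fun u hu => ?_
    rw [tsum_mul_left, (hasSum_bose hβ hu).tsum_eq]
  · refine Summable.of_nonneg_of_le
      (fun k => integral_nonneg fun u => norm_nonneg (φ u * exp (-(β * (k + 1)) * u)))
      (fun k => ?_) ((summable_one_div_const_mul_sq β).mul_left A)
    rw [← integral_mul_exp_neg (by positivity : 0 < β * ((k : ℝ) + 1)),
      ← integral_const_mul]
    exact setIntegral_mono_on (hi' k).norm (hi k) measurableSet_Ioi fun u hu => hb k u hu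

lemma integral_mul_bose (hβ : 0 < β) :
    ∫ u in Ioi (0 : ℝ), u * bose β u = π ^ 2 / (6 * β ^ 2) := by
  have h := hasSum_integral_mul_bose hβ measurable_id (A := 1)
    (fun u hu => by simp [abs_of_pos hu])
  simp only [id] at h
  refine h.unique ?_
  have h2 := ((hasSum_nat_add_iff' 1).mpr hasSum_zeta_two).mul_left (1 / β ^ 2)
  convert! h2 using 1
  · ext k
    rw [integral_mul_exp_neg (by positivity)]
    push_cast
    rw [mul_pow, one_div_mul_one_div]
  · simp; field_simp

lemma integral_sin_mul_exp_neg {c : ℝ} (hc : 0 < c) (a : ℝ) :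
    ∫ u in Ioi (0 : ℝ), sin (a * u) * exp (-c * u) = a / (c ^ 2 + a ^ 2) := by
  have hre : (-(c : ℂ) + a * Complex.I).re < 0 := by simp [hc]
  have h := integral_exp_mul_complex_Ioi hre 0
  have hi : IntegrableOn (fun u : ℝ => Complex.exp ((-(c : ℂ) + a * Complex.I) * u)) (Ioi 0) :=
    integrableOn_exp_mul_complex_Ioi hre 0
  have h2 : (∫ u in Ioi (0 : ℝ), Complex.exp ((-(c : ℂ) + a * Complex.I) * u)).im =
      ∫ u in Ioi (0 : ℝ), sin (a * u) * exp (-c * u) := by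
    rw [← Complex.imCLM_apply, ← ContinuousLinearMap.integral_comp_comm _ hi]
    congr 1
    ext u
    rw [Complex.imCLM_apply, Complex.exp_im]
    simp [mul_comm]
  rw [← h2, h]
  have hne : c ^ 2 + a ^ 2 ≠ 0 := by positivity
  simp [Complex.div_im, Complex.normSq]
  ring

/-! ### The sine transform of the weight -/

/-- The sine transform `∫_0^∞ sin(2πξu) / (e^{βu} - 1) du`. -/
noncomputable def boseSine (β ξ : ℝ) : ℝ := ∫ u in Ioi (0 : ℝ), sin (2 * π * ξ * u) * bose β u

/-- The derivative in `ξ` of `boseSine β ξ`, with the differentiation carried out under the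
integral. -/
noncomputable def boseSineDeriv (β ξ : ℝ) : ℝ :=
  ∫ u in Ioi (0 : ℝ), 2 * π * u * cos (2 * π * ξ * u) * bose β u

lemma abs_sin_mul_le (a : ℝ) {u : ℝ} (hu : 0 < u) : |sin (a * u)| ≤ |a| * u := by
  calc |sin (a * u)| ≤ |a * u| := Real.abs_sin_le_abs
    _ = |a| * u := by rw [abs_mul, abs_of_pos hu]

lemma abs_mul_cos_le (a : ℝ) {u : ℝ} (hu : 0 < u) : |2 * π * u * cos (a * u)| ≤ 2 * π * u := by
  rw [abs_mul, abs_of_pos (by positivity : 0 < 2 * π * u)]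
  exact mul_le_of_le_one_right (by positivity) (abs_cos_le_one _)

lemma integrableOn_sin_mul_bose (hβ : 0 < β) (a : ℝ) :
    IntegrableOn (fun u => sin (a * u) * bose β u) (Ioi 0) :=
  integrableOn_mul_bose_of_le hβ (by fun_prop) fun _ hu => abs_sin_mul_le a hu

lemma integrableOn_mul_bose (hβ : 0 < β) :
    IntegrableOn (fun u => u * bose β u) (Ioi 0) :=
  integrableOn_mul_bose_of_le hβ measurable_id (A := 1) fun u hu => by simp [abs_of_pos hu]

lemma hasDerivAt_boseSine (hβ : 0 < β) (ξ : ℝ) :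
    HasDerivAt (boseSine β) (boseSineDeriv β ξ) ξ := by
  have hbd := ((integrableOn_mul_bose hβ).const_mul (2 * π))
  refine (hasDerivAt_integral_of_dominated_loc_of_deriv_le (s := univ)
    (bound := fun u => 2 * π * (u * bose β u))
    (F := fun ξ u => sin (2 * π * ξ * u) * bose β u)
    (F' := fun ξ u => 2 * π * u * cos (2 * π * ξ * u) * bose β u) univ_mem ?_ ?_ ?_ ?_ hbd ?_).2
  · refine Eventually.of_forall fun x => ?_
    exact ((by fun_prop : Measurable fun u => sin (2 * π * x * u)).mul
      measurable_bose).aestronglyMeasurable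
  · exact integrableOn_sin_mul_bose hβ _
  · exact ((by fun_prop : Measurable fun u => 2 * π * u * cos (2 * π * ξ * u)).mul
      measurable_bose).aestronglyMeasurable
  · filter_upwards [ae_restrict_mem measurableSet_Ioi] with u hu x _
    have hu : 0 < u := hu
    have := bose_pos hβ hu
    rw [norm_mul, Real.norm_eq_abs, Real.norm_eq_abs, abs_of_pos this, ← mul_assoc]
    gcongr
    exact abs_mul_cos_le _ hu
  · refine Eventually.of_forall fun u x _ => ?_
    have h : HasDerivAt (fun x => 2 * π * x * u) (2 * π * u) x := by
      simpa using ((hasDerivAt_id x).const_mul (2 * π)).mul_const u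
    convert! (h.sin).mul_const (bose β u) using 1
    ring

lemma continuous_boseSineDeriv (hβ : 0 < β) : Continuous (boseSineDeriv β) := by
  have hbd := ((integrableOn_mul_bose hβ).const_mul (2 * π))
  refine continuous_of_dominated (fun x => ?_) (fun x => ?_) hbd (Eventually.of_forall fun u => ?_)
  · exact ((by fun_prop : Measurable fun u => 2 * π * u * cos (2 * π * x * u)).mul
      measurable_bose).aestronglyMeasurable
  · filter_upwards [ae_restrict_mem measurableSet_Ioi] with u hu
    have hu : 0 < u := hu
    have := bose_pos hβ hu
    rw [norm_mul, Real.norm_eq_abs, Real.norm_eq_abs, abs_of_pos this, ← mul_assoc]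
    gcongr
    exact abs_mul_cos_le _ hu
  · fun_prop

lemma continuous_boseSine (hβ : 0 < β) : Continuous (boseSine β) :=
  continuous_iff_continuousAt.mpr fun ξ => (hasDerivAt_boseSine hβ ξ).continuousAt

lemma hasSum_boseSine (hβ : 0 < β) (ξ : ℝ) :
    HasSum (fun k : ℕ => 2 * π * ξ / ((β * (k + 1)) ^ 2 + (2 * π * ξ) ^ 2)) (boseSine β ξ) := by
  have h := hasSum_integral_mul_bose hβ (φ := fun u => sin (2 * π * ξ * u)) (by fun_prop)
    fun _ hu => abs_sin_mul_le _ hu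
  convert! h using 1
  ext k
  rw [integral_sin_mul_exp_neg (by positivity)]

/-- Closed form of the sine transform: a hyperbolic cotangent minus its pole. -/
lemma boseSine_eq (hβ : 0 < β) {ξ : ℝ} (hξ : ξ ≠ 0) :
    4 * π * boseSine β ξ =
      4 * π ^ 2 / β / (exp (4 * π ^ 2 / β * ξ) - 1) + 2 * π ^ 2 / β - 1 / ξ := by
  -- partial fractions of the cotangent at the purely imaginary point `2πξ/β * I`
  set y : ℝ := 2 * π * ξ / β with hy
  have hy0 : y ≠ 0 := by positivity
  have hz : (y * Complex.I : ℂ) ∈ Complex.integerComplement := by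
    rintro ⟨n, hn⟩
    have := congrArg Complex.im hn
    simp at this
    exact hy0 this.symm
  have h1 := cot_series_rep hz
  have h2 : ∑' n : ℕ+, (1 / (y * Complex.I - n) + 1 / (y * Complex.I + n)) =
      ((-(2 * β) * boseSine β ξ : ℝ) : ℂ) * Complex.I := by
    rw [tsum_pnat_eq_tsum_succ
        (f := fun n : ℕ => 1 / (y * Complex.I - n) + 1 / (y * Complex.I + n)),
      ← (hasSum_boseSine hβ ξ).tsum_eq, ← tsum_mul_left, Complex.ofReal_tsum, ← tsum_mul_right]
    congr 1
    ext k
    have hk : (y * Complex.I - (k + 1 : ℕ) : ℂ) ≠ 0 := by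
      intro h
      have := congrArg Complex.im h
      simp [hy0] at this
    have hk' : (y * Complex.I + (k + 1 : ℕ) : ℂ) ≠ 0 := by
      intro h
      have := congrArg Complex.im h
      simp [hy0] at this
    have hs : (k + 1 : ℝ) ^ 2 + y ^ 2 ≠ 0 := by positivity
    have e : -(2 * β) * (2 * π * ξ / ((β * (k + 1)) ^ 2 + (2 * π * ξ) ^ 2)) =
        -2 * y / ((k + 1) ^ 2 + y ^ 2) := by
      have : 2 * π * ξ = β * y := by rw [hy]; field_simp
      rw [this]
      have : (β * (k + 1)) ^ 2 + (β * y) ^ 2 = β ^ 2 * ((k + 1) ^ 2 + y ^ 2) := by ring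
      rw [this]
      field_simp
    rw [e, div_add_div _ _ hk hk']
    have hs' : ((k + 1 : ℂ) ^ 2 + (y : ℂ) ^ 2) ≠ 0 := by exact_mod_cast hs
    push_cast at hk hk' ⊢
    have hp : (y * Complex.I - (k + 1)) * (y * Complex.I + (k + 1)) =
        -((k + 1 : ℂ) ^ 2 + (y : ℂ) ^ 2) := by
      linear_combination (y : ℂ) ^ 2 * Complex.I_sq
    rw [hp, div_neg, div_mul_eq_mul_div, ← neg_div]
    congr 1
    ring
  rw [h2, ← mul_assoc, Complex.cot_eq_cos_div_sin] at h1
  have h3 : (π : ℂ) * y = ((π * y : ℝ) : ℂ) := by push_cast; ring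
  rw [h3, Complex.cos_mul_I, Complex.sin_mul_I, ← Complex.ofReal_cosh, ← Complex.ofReal_sinh] at h1
  have hsh : sinh (π * y) ≠ 0 := by
    rw [Ne, Real.sinh_eq_zero]; positivity
  have h4 : π * (cosh (π * y) / sinh (π * y)) = 1 / y + 2 * β * boseSine β ξ := by
    have hy' : (y : ℂ) ≠ 0 := by exact_mod_cast hy0
    have hsh' : ((sinh (π * y) : ℝ) : ℂ) ≠ 0 := by exact_mod_cast hsh
    have h5 := congrArg (fun z : ℂ => z * Complex.I) h1
    have : ((π * (cosh (π * y) / sinh (π * y)) : ℝ) : ℂ) =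
        ((1 / y + 2 * β * boseSine β ξ : ℝ) : ℂ) := by
      push_cast
      push_cast at h5
      field_simp at h5 ⊢
      linear_combination h5 - 2 * β * y * boseSine β ξ * Complex.I_sq
    exact_mod_cast this
  have h6 : cosh (π * y) / sinh (π * y) = 2 / (exp (4 * π ^ 2 / β * ξ) - 1) + 1 := by
    have e1 : exp (4 * π ^ 2 / β * ξ) = exp (π * y) ^ 2 := by
      rw [← Real.exp_nat_mul]; congr 1; rw [hy]; push_cast; field_simp; ring
    have e2 : exp (π * y) ^ 2 - 1 ≠ 0 := by
      rw [← e1, sub_ne_zero, Ne, Real.exp_eq_one_iff]; positivity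
    rw [Real.sinh_eq] at hsh
    rw [e1, Real.cosh_eq, Real.sinh_eq, Real.exp_neg]
    rw [Real.exp_neg] at hsh
    have := exp_pos (π * y)
    field_simp
    ring
  rw [h6] at h4
  have h7 : 1 / y = β / (2 * π) * (1 / ξ) := by rw [hy]; field_simp
  rw [h7] at h4
  have h8 : boseSine β ξ = (π * (2 / (exp (4 * π ^ 2 / β * ξ) - 1) + 1) -
    β / (2 * π) * (1 / ξ)) / (2 * β) := by
    rw [eq_div_iff (by positivity)]; linarith
  have e2 : exp (4 * π ^ 2 / β * ξ) - 1 ≠ 0 := by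
    rw [sub_ne_zero, Ne, Real.exp_eq_one_iff]; positivity
  rw [h8]
  field_simp
  ring

/-! ### The Riemann–Lebesgue lemma and the Dirichlet integral -/

lemma tendsto_boseSine (hβ : 0 < β) : Tendsto (boseSine β) atTop (𝓝 (π / (2 * β))) := by
  have h1 : Tendsto (fun ξ : ℝ => exp (4 * π ^ 2 / β * ξ) - 1) atTop atTop :=
    tendsto_atTop_add_const_right _ _
      (tendsto_exp_atTop.comp (tendsto_id.const_mul_atTop (by positivity)))
  have h2 : Tendsto (fun ξ : ℝ => (4 * π ^ 2 / β / (exp (4 * π ^ 2 / β * ξ) - 1) +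
      2 * π ^ 2 / β - 1 / ξ) / (4 * π)) atTop (𝓝 ((0 + 2 * π ^ 2 / β - 0) / (4 * π))) :=
    (((h1.const_div_atTop _).add_const _).sub (tendsto_id.const_div_atTop 1)).div_const _
  have h3 : (0 + 2 * π ^ 2 / β - 0) / (4 * π) = π / (2 * β) := by field_simp; ring
  rw [h3] at h2
  refine h2.congr' ?_
  filter_upwards [eventually_gt_atTop 0] with ξ hξ
  rw [← boseSine_eq hβ hξ.ne']
  field_simp

/-- The Riemann–Lebesgue lemma for sine transforms on the half-line. -/
lemma tendsto_integral_sin_mul {f : ℝ → ℝ} (hf : IntegrableOn f (Ioi 0)) :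
    Tendsto (fun a : ℝ => ∫ t in Ioi (0 : ℝ), sin (2 * π * a * t) * f t) atTop (𝓝 0) := by
  have h := (Real.tendsto_integral_exp_smul_cocompact
    (fun t => (((Ioi 0).indicator f t : ℝ) : ℂ))).mono_left atTop_le_cocompact
  have h2 := ((Complex.continuous_im.tendsto _).comp h).neg
  simp only [Complex.zero_im, neg_zero] at h2
  refine h2.congr fun a => ?_
  have hi : Integrable (fun t : ℝ => Real.fourierChar (-(t * a)) •
      (((Ioi 0).indicator f t : ℝ) : ℂ)) := by
    have := (hf.integrable_indicator measurableSet_Ioi).ofReal (𝕜 := ℂ)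
    refine this.mono ?_ ?_
    · simp only [Circle.smul_def, smul_eq_mul]
      refine AEStronglyMeasurable.mul ?_ this.aestronglyMeasurable
      exact (by fun_prop : Continuous fun t : ℝ =>
        ((Real.fourierChar (-(t * a)) : Circle) : ℂ)).aestronglyMeasurable
    · exact Eventually.of_forall fun t => by simp
  simp only [Function.comp]
  rw [← Complex.imCLM_apply, ← ContinuousLinearMap.integral_comp_comm _ hi, ← integral_neg,
    ← integral_indicator measurableSet_Ioi]
  congr 1
  ext t
  rw [Complex.imCLM_apply, Circle.smul_def, Real.fourierChar_apply]
  by_cases ht : t ∈ Ioi (0 : ℝ)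
  · simp [indicator_of_mem ht, Complex.exp_im]
    left
    congr 1
    ring
  · simp [indicator_of_notMem ht]

/-- `∫_0^{1/2} sin(2πav)/v dv`, with the integrand written through `sinc` so that it is continuous
at `v = 0`. -/
noncomputable def windowSine (a : ℝ) : ℝ :=
  ∫ v in (0 : ℝ)..(1 / 2), 2 * π * a * sinc (2 * π * a * v)

lemma mul_sinc_mul (a : ℝ) {v : ℝ} (hv : v ≠ 0) :
    a * sinc (a * v) = sin (a * v) / v := by
  rcases eq_or_ne a 0 with rfl | ha
  · simp
  · rw [sinc_of_ne_zero (mul_ne_zero ha hv)]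
    field_simp

/-- The weight minus its pole `1 / (βu)`, the latter cut off at `u = 1/2`, is integrable. -/
lemma integrableOn_bose_sub (hβ : 0 < β) :
    IntegrableOn (fun u => bose β u - (Ioc 0 (1 / 2)).indicator (fun u => 1 / (β * u)) u)
      (Ioi 0) := by
  -- on the window the difference lies between `-1` and `0`; beyond it `bose` decays
  have hm : Measurable fun u => bose β u - (Ioc (0:ℝ) (1 / 2)).indicator (fun u => 1 / (β * u)) u :=
    measurable_bose.sub ((by fun_prop : Measurable fun u : ℝ => 1 / (β * u)).indicator
      measurableSet_Ioc)
  obtain ⟨C, hC, h⟩ := exists_mul_bose_le hβ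
  have hb : ∀ u > 0, 1 / (β * u) - 1 ≤ bose β u := by
    intro u hu
    have hx : 0 < β * u := by positivity
    have h1 : exp (-(β * u)) ≥ 1 - β * u := by linarith [Real.add_one_le_exp (-(β * u))]
    have h2 := exp_mul_sub_one_pos hβ hu
    unfold bose
    have h3 : exp (-(β * u)) * exp (β * u) = 1 := by rw [← Real.exp_add]; simp
    rw [sub_le_iff_le_add, div_add_one h2.ne', div_le_div_iff₀ hx h2]
    nlinarith [exp_pos (β * u)]
  refine Integrable.mono' ((integrable_inv_one_add_sq.const_mul (2 * C + 2)).integrableOn)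
    hm.aestronglyMeasurable ?_
  filter_upwards [ae_restrict_mem measurableSet_Ioi] with u hu
  have hu : 0 < u := hu
  have hpos := bose_pos hβ hu
  rw [Real.norm_eq_abs]
  by_cases hw : u ≤ 1 / 2
  · rw [indicator_of_mem (show u ∈ Ioc 0 (1 / 2) from ⟨hu, hw⟩)]
    have h1 := bose_le hβ hu one_ne_zero
    simp only [Nat.factorial_one, Nat.cast_one, pow_one] at h1
    have h2 := hb u hu
    have h3 : (1 : ℝ) ≤ 2 * (1 + u ^ 2)⁻¹ := by
      rw [← div_eq_mul_inv, le_div_iff₀ (by positivity)]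
      nlinarith
    have h4 : 0 ≤ C * (1 + u ^ 2)⁻¹ := by positivity
    rw [abs_le]
    constructor <;> nlinarith
  · rw [indicator_of_notMem (fun hh => hw hh.2), sub_zero, abs_of_pos hpos]
    push Not at hw
    have h1 := h u hu
    have h2 : 0 < (1 + u ^ 2)⁻¹ := by positivity
    nlinarith

/-- The Dirichlet integral. It is read off from the limit of `boseSine 1`, whose closed form is
known: the two differ by the sine transform of an integrable function. -/
lemma tendsto_windowSine : Tendsto windowSine atTop (𝓝 (π / 2)) := by
  have hβ : (0 : ℝ) < 1 := one_pos
  have h1 := (tendsto_boseSine hβ).sub (tendsto_integral_sin_mul (integrableOn_bose_sub hβ))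
  rw [sub_zero, mul_one] at h1
  refine h1.congr fun a => ?_
  have hi := integrableOn_sin_mul_bose hβ (2 * π * a)
  have hi2 : IntegrableOn (fun u => sin (2 * π * a * u) *
      (bose 1 u - (Ioc 0 (1 / 2)).indicator (fun u => 1 / (1 * u)) u)) (Ioi 0) :=
    (integrableOn_bose_sub hβ).bdd_mul (c := 1) (by fun_prop)
      (Eventually.of_forall fun u => by simpa using abs_sin_le_one _)
  rw [boseSine, ← integral_sub hi hi2, windowSine, intervalIntegral.integral_of_le (by norm_num)]
  rw [← integral_indicator measurableSet_Ioi, ← integral_indicator measurableSet_Ioc]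
  congr 1
  ext u
  by_cases hu : u ∈ Ioi (0 : ℝ)
  · rw [indicator_of_mem hu]
    by_cases hw : u ∈ Ioc (0 : ℝ) (1 / 2)
    · simp only [indicator_of_mem hw]
      rw [mul_sinc_mul _ hw.1.ne']
      ring
    · simp only [indicator_of_notMem hw]
      ring
  · rw [indicator_of_notMem hu, indicator_of_notMem fun hw : u ∈ Ioc (0:ℝ) (1/2) => hu hw.1]

/-! ### Principal values by splitting off the pole -/

/-- Evaluation of a principal value: if `f` is an integrable function `F` plus a simple pole
`P t / (2 (1 - t))` cut off to the window `(1/2, 3/2)`, then the reflection `t ↦ 2 - t` turns the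
pole into the integral of the difference quotient `Q` of `P`, and the truncated integrals
converge. -/
lemma truncatedIntegral_of_decomposition {f F P Q : ℝ → ℝ} (hF : IntegrableOn F (Ioi 0))
    (hP : Continuous P) (hQ : Continuous Q)
    (hPQ : ∀ v, v ≠ 0 → (P (1 - v) - P (1 + v)) / (2 * v) = Q v)
    (hf : ∀ t > 0, t ≠ 1 →
      f t = F t + (Ioo (1 / 2) (3 / 2)).indicator (fun t => P t / (2 * (1 - t))) t) :
    (∀ ε : ℝ, 0 < ε → IntegrableOn f (Ioo 0 (1 - ε))) ∧
    (∀ ε : ℝ, 0 < ε → IntegrableOn f (Ioi (1 + ε))) ∧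
    Tendsto (truncatedIntegral f) (𝓝[>] 0)
      (𝓝 ((∫ t in Ioi (0 : ℝ), F t) + ∫ v in (0 : ℝ)..(1 / 2), Q v)) := by
  set W : ℝ → ℝ := (Ioo (1 / 2) (3 / 2)).indicator (fun t => P t / (2 * (1 - t))) with hW
  have hsubL : ∀ ε : ℝ, Ioo 0 (1 - ε) ⊆ Ioi 0 := fun ε t ht => ht.1
  have hsubR : ∀ ε : ℝ, 0 < ε → Ioi (1 + ε) ⊆ Ioi (0 : ℝ) := fun ε hε t ht => by
    simp only [mem_Ioi] at *; linarith
  have hfL : ∀ ε : ℝ, 0 < ε → EqOn f (fun t => F t + W t) (Ioo 0 (1 - ε)) := fun ε hε t ht =>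
    hf t ht.1 (by linarith [ht.2])
  have hfR : ∀ ε : ℝ, 0 < ε → EqOn f (fun t => F t + W t) (Ioi (1 + ε)) := fun ε hε t ht => by
    have ht : 1 + ε < t := ht
    exact hf t (by linarith) (by linarith)
  have hcont : ∀ a b : ℝ, (1 : ℝ) ∉ Icc a b →
      ContinuousOn (fun t => P t / (2 * (1 - t))) (Icc a b) := by
    intro a b h1
    refine ContinuousOn.div hP.continuousOn (by fun_prop) fun t ht h0 => h1 ?_
    have : t = 1 := by linarith
    rwa [this] at ht
  have hWL : ∀ ε : ℝ, 0 < ε → IntegrableOn W (Ioo 0 (1 - ε)) := fun ε hε => by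
    rw [hW, integrableOn_indicator_iff measurableSet_Ioo]
    refine IntegrableOn.mono_set (hcont (1 / 2) (1 - ε)
      (fun h => by linarith [h.2])).integrableOn_Icc ?_
    exact fun t ht => ⟨ht.1.1.le, ht.2.2.le⟩
  have hWR : ∀ ε : ℝ, 0 < ε → IntegrableOn W (Ioi (1 + ε)) := fun ε hε => by
    rw [hW, integrableOn_indicator_iff measurableSet_Ioo]
    refine IntegrableOn.mono_set (hcont (1 + ε) (3 / 2)
      (fun h => by linarith [h.1])).integrableOn_Icc ?_
    exact fun t ht => ⟨le_of_lt ht.2, ht.1.2.le⟩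
  refine ⟨fun ε hε => ?_, fun ε hε => ?_, ?_⟩
  · exact ((hF.mono_set (hsubL ε)).add (hWL ε hε)).congr_fun (hfL ε hε).symm measurableSet_Ioo
  · exact ((hF.mono_set (hsubR ε hε)).add (hWR ε hε)).congr_fun (hfR ε hε).symm measurableSet_Ioi
  -- the window parts of the two truncated integrals combine by the reflection `t ↦ 2 - t`
  have hwin : ∀ ε : ℝ, 0 < ε → ε < 1 / 2 →
      (∫ t in Ioo 0 (1 - ε), W t) + ∫ t in Ioi (1 + ε), W t = ∫ v in ε..(1 / 2), Q v := by
    intro ε hε hε2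
    have eL : (∫ t in Ioo 0 (1 - ε), W t) = ∫ v in ε..(1 / 2), P (1 - v) / (2 * v) := by
      rw [hW, setIntegral_indicator measurableSet_Ioo]
      have : Ioo 0 (1 - ε) ∩ Ioo (1 / 2) (3 / 2) = Ioo (1 / 2) (1 - ε) := by
        ext t; simp only [mem_inter_iff, mem_Ioo]
        constructor
        · rintro ⟨⟨_, h2⟩, h3, _⟩; exact ⟨h3, h2⟩
        · rintro ⟨h1, h2⟩; exact ⟨⟨by linarith, h2⟩, h1, by linarith⟩
      rw [this, ← integral_Ioc_eq_integral_Ioo, ← intervalIntegral.integral_of_le (by linarith)]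
      have h := intervalIntegral.integral_comp_sub_left (a := ε) (b := 1 / 2)
        (fun t => P t / (2 * (1 - t))) 1
      rw [show (1 : ℝ) - 1 / 2 = 1 / 2 by norm_num] at h
      rw [← h]
      simp
    have eR : (∫ t in Ioi (1 + ε), W t) = ∫ v in ε..(1 / 2), -(P (1 + v) / (2 * v)) := by
      rw [hW, setIntegral_indicator measurableSet_Ioo]
      have : Ioi (1 + ε) ∩ Ioo (1 / 2) (3 / 2) = Ioo (1 + ε) (3 / 2) := by
        ext t; simp only [mem_inter_iff, mem_Ioo, mem_Ioi]
        constructor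
        · rintro ⟨h2, h3, h4⟩; exact ⟨h2, h4⟩
        · rintro ⟨h1, h2⟩; exact ⟨h1, by linarith, h2⟩
      rw [this, ← integral_Ioc_eq_integral_Ioo, ← intervalIntegral.integral_of_le (by linarith)]
      have h := intervalIntegral.integral_comp_add_left (a := ε) (b := 1 / 2)
        (fun t => P t / (2 * (1 - t))) 1
      rw [show (1 : ℝ) + 1 / 2 = 3 / 2 by norm_num] at h
      rw [← h]
      refine intervalIntegral.integral_congr fun v _ => ?_
      rw [show 2 * (1 - (1 + v)) = -(2 * v) by ring, div_neg]
    have hne : ∀ v ∈ uIcc ε (1 / 2), 2 * v ≠ 0 := by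
      intro v hv
      rw [uIcc_of_le hε2.le] at hv
      have := hv.1
      exact (by linarith : 0 < 2 * v).ne'
    rw [eL, eR, ← intervalIntegral.integral_add]
    · refine intervalIntegral.integral_congr fun v hv => ?_
      rw [← hPQ v (fun h => hne v hv (by simp [h]))]
      ring
    · refine ContinuousOn.intervalIntegrable (ContinuousOn.div (by fun_prop) (by fun_prop) hne)
    · refine ContinuousOn.intervalIntegrable (ContinuousOn.div (by fun_prop) (by fun_prop) hne).neg
  have hFlim : Tendsto (fun ε : ℝ => (∫ t in Ioo 0 (1 - ε), F t) + ∫ t in Ioi (1 + ε), F t) (𝓝[>] 0)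
      (𝓝 (∫ t in Ioi (0 : ℝ), F t)) := by
    have h := tendsto_integral_filter_of_dominated_convergence (μ := volume.restrict (Ioi (0 : ℝ)))
      (l := 𝓝[>] (0 : ℝ)) (F := fun ε => (Ioo 0 (1 - ε) ∪ Ioi (1 + ε)).indicator F) (f := F)
      (fun t => ‖F t‖) ?_ ?_ hF.norm ?_
    · refine h.congr' ?_
      filter_upwards [self_mem_nhdsWithin] with ε hε
      have hε : 0 < ε := hε
      rw [setIntegral_indicator (measurableSet_Ioo.union measurableSet_Ioi),
        inter_eq_right.mpr (union_subset (hsubL ε) (hsubR ε hε)),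
        setIntegral_union ?_ measurableSet_Ioi (hF.mono_set (hsubL ε)) (hF.mono_set (hsubR ε hε))]
      rw [disjoint_left]
      intro t ht ht'
      have : 1 + ε < t := ht'
      linarith [ht.2]
    · exact Eventually.of_forall fun ε =>
        hF.aestronglyMeasurable.indicator (measurableSet_Ioo.union measurableSet_Ioi)
    · exact Eventually.of_forall fun ε => Eventually.of_forall fun t =>
        norm_indicator_le_norm_self F t
    · have h1 : ∀ᵐ t ∂(volume.restrict (Ioi (0 : ℝ))), t ≠ 1 :=
        ae_restrict_of_ae (Measure.ae_ne volume 1)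
      filter_upwards [ae_restrict_mem measurableSet_Ioi, h1] with t ht ht1
      have ht : 0 < t := ht
      refine tendsto_const_nhds.congr' ?_
      have : Ioo 0 |t - 1| ∈ 𝓝[>] (0 : ℝ) := Ioo_mem_nhdsGT (abs_pos.mpr (sub_ne_zero.mpr ht1))
      filter_upwards [this] with ε hε
      rw [indicator_of_mem]
      rcases lt_or_gt_of_ne ht1 with h | h
      · left
        have := hε.2
        rw [abs_of_neg (by linarith)] at this
        exact ⟨ht, by linarith⟩
      · right
        have := hε.2
        rw [abs_of_pos (by linarith)] at this
        show 1 + ε < t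
        linarith
  have hQlim : Tendsto (fun ε : ℝ => ∫ v in ε..(1 / 2), Q v) (𝓝[>] 0)
      (𝓝 (∫ v in (0 : ℝ)..(1 / 2), Q v)) := by
    have : Continuous fun ε : ℝ => ∫ v in ε..(1 / 2), Q v := by
      have h := intervalIntegral.continuous_primitive (μ := volume)
        (fun a b => hQ.intervalIntegrable a b) (1 / 2)
      simp_rw [intervalIntegral.integral_symm (1 / 2 : ℝ)]
      exact h.neg
    exact (this.tendsto 0).mono_left nhdsWithin_le_nhds
  refine (hFlim.add hQlim).congr' ?_
  filter_upwards [Ioo_mem_nhdsGT (show (0 : ℝ) < 1 / 2 by norm_num)] with ε hε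
  rw [truncatedIntegral, setIntegral_congr_fun measurableSet_Ioo (hfL ε hε.1),
    setIntegral_congr_fun measurableSet_Ioi (hfR ε hε.1),
    integral_add (hF.mono_set (hsubL ε)) (hWL ε hε.1),
    integral_add (hF.mono_set (hsubR ε hε.1)) (hWR ε hε.1), ← hwin ε hε.1 hε.2]
  ring

/-! ### The regular part of a single mode -/

/-- The function `t² / (n (e^{βnt} - 1) (1 - t²))` with its pole at `t = 1` removed on the window
`(1/2, 3/2)`; the subtracted numerator `(1 + t)/2` makes the removed pole exactly
`1 / (2 (1 - t))` times the constant `bose β n / n`. -/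
noncomputable def regularPart (β : ℝ) (n : ℕ+) (t : ℝ) : ℝ :=
  (t ^ 2 * bose β (n * t) -
    (Ioo (1 / 2) (3 / 2)).indicator (fun t => bose β n * ((1 + t) / 2)) t) / (n * (1 - t ^ 2))

lemma one_sub_sq_ne_zero {t : ℝ} (ht : 0 < t) (ht1 : t ≠ 1) : 1 - t ^ 2 ≠ 0 := by
  have h : (1 - t) * (1 + t) ≠ 0 := mul_ne_zero (sub_ne_zero.mpr ht1.symm) (by positivity)
  intro h0
  exact h (by linarith)

lemma one_le_pnat_cast (n : ℕ+) : (1 : ℝ) ≤ n := by exact_mod_cast Nat.succ_le_of_lt n.pos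

lemma pnat_cast_pos (n : ℕ+) : (0 : ℝ) < n := by exact_mod_cast n.pos

lemma summable_one_div_pnat_sq : Summable fun n : ℕ+ => 1 / (n : ℝ) ^ 2 :=
  (Real.summable_one_div_nat_pow.mpr one_lt_two).comp_injective PNat.coe_injective

lemma bose_sub_le (hβ : 0 < β) {a b : ℝ} (ha : 0 < a) (hab : a ≤ b) :
    |bose β a - bose β b| ≤ β * (b - a) * (bose β a * (1 + bose β b)) := by
  have hb : 0 < b := ha.trans_le hab
  have h1 := exp_mul_sub_one_pos hβ ha
  have h2 := exp_mul_sub_one_pos hβ hb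
  have e1 : bose β a - bose β b = (exp (β * b) - exp (β * a)) * (bose β a * bose β b) := by
    unfold bose; field_simp; ring
  have e2 : exp (β * b) * bose β b = 1 + bose β b := by
    unfold bose; field_simp; ring
  have e3 : exp (β * a) = exp (β * b) * exp (-(β * (b - a))) := by
    rw [← Real.exp_add]; congr 1; ring
  have h3 : exp (β * b) - exp (β * a) ≤ exp (β * b) * (β * (b - a)) := by
    rw [e3]
    nlinarith [exp_pos (β * b), Real.add_one_le_exp (-(β * (b - a)))]
  have h4 : 0 ≤ exp (β * b) - exp (β * a) := by
    rw [sub_nonneg]; gcongr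
  have p1 := bose_pos hβ ha
  have p2 := bose_pos hβ hb
  rw [e1, abs_of_nonneg (by positivity), ← e2]
  calc _ ≤ exp (β * b) * (β * (b - a)) * (bose β a * bose β b) := by gcongr
    _ = _ := by ring

lemma bose_anti (hβ : 0 < β) {a b : ℝ} (ha : 0 < a) (hab : a ≤ b) : bose β b ≤ bose β a := by
  have := exp_mul_sub_one_pos hβ ha
  unfold bose
  gcongr

/-- A Lipschitz bound for `t ↦ bose β (n t)` at `t = 1` that decays in `n`. -/
lemma exists_abs_bose_sub_le (hβ : 0 < β) :
    ∃ C > 0, ∀ n : ℕ+, ∀ t : ℝ, 1 / 2 < t →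
      |bose β (n * t) - bose β n| ≤ C / n ^ 2 * |t - 1| := by
  set B := bose β (1 / 2) with hB
  have hBpos : 0 < B := bose_pos hβ (by norm_num)
  refine ⟨48 * (1 + B) / β ^ 2, by positivity, fun n t ht => ?_⟩
  have hn := one_le_pnat_cast n
  have key : ∀ a b : ℝ, (n : ℝ) / 2 ≤ a → a ≤ b →
      |bose β a - bose β b| ≤ 48 * (1 + B) / β ^ 2 / n ^ 3 * (b - a) := by
    intro a b ha hab
    have ha0 : 0 < a := by linarith
    have h1 := bose_le hβ (by positivity : (0 : ℝ) < n / 2) three_ne_zero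
    have h2 := (bose_anti hβ (by positivity) ha).trans h1
    have h3 : bose β b ≤ B := bose_anti hβ (by norm_num) (by linarith)
    have hp := bose_pos hβ ha0
    have hp' := bose_pos hβ (ha0.trans_le hab)
    calc _ ≤ β * (b - a) * (bose β a * (1 + bose β b)) := bose_sub_le hβ ha0 hab
      _ ≤ β * (b - a) * ((Nat.factorial 3 : ℕ) / (β * (n / 2)) ^ 3 * (1 + B)) := by
        have : 0 ≤ b - a := by linarith
        gcongr
      _ = _ := by simp [Nat.factorial]; field_simp; ring
  have e : ∀ x : ℝ, 48 * (1 + B) / β ^ 2 / n ^ 3 * (n * x) = 48 * (1 + B) / β ^ 2 / n ^ 2 * x := by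
    intro x; field_simp
  rcases le_total t 1 with h | h
  · have := key (n * t) n (by nlinarith) (by nlinarith)
    rw [abs_of_nonpos (by linarith : t - 1 ≤ 0), ← e]
    convert this using 2; ring
  · have := key n (n * t) (by nlinarith) (by nlinarith)
    rw [abs_of_nonneg (by linarith : 0 ≤ t - 1), ← e, abs_sub_comm]
    convert this using 2; ring

/-- A bound that is integrable in `t` and summable in `n` at the same time. -/
lemma exists_abs_regularPart_le (hβ : 0 < β) :
    ∃ C > 0, ∀ n : ℕ+, ∀ t > 0, t ≠ 1 → |regularPart β n t| ≤ C / n ^ 2 * (1 + t ^ 2)⁻¹ := by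
  obtain ⟨C, hC, hlip⟩ := exists_abs_bose_sub_le hβ
  refine ⟨4 * (9 / 4 * C + 4 / β ^ 2) + 6 / β ^ 2, by positivity, fun n t ht ht1 => ?_⟩
  have hn := one_le_pnat_cast n
  have hn0 := pnat_cast_pos n
  rw [← div_eq_mul_inv, div_div, le_div_iff₀ (by positivity)]
  by_cases hw : t ∈ Ioo (1 / 2 : ℝ) (3 / 2)
  · have ht' : 0 < |t - 1| := abs_pos.mpr (sub_ne_zero.mpr ht1)
    have h1 := hlip n t hw.1
    have h2 := bose_le hβ hn0 two_ne_zero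
    have hp := bose_pos hβ hn0
    have e : t ^ 2 * bose β (n * t) - bose β n * ((1 + t) / 2) =
        t ^ 2 * (bose β (n * t) - bose β n) + bose β n * ((t - 1) * (t + 1 / 2)) := by ring
    have h3 : |t ^ 2 * bose β (n * t) - bose β n * ((1 + t) / 2)| ≤
        (9 / 4 * C + 4 / β ^ 2) / n ^ 2 * |t - 1| := by
      rw [e]
      refine (abs_add_le _ _).trans ?_
      rw [abs_mul, abs_mul, abs_mul, abs_of_pos hp, abs_of_pos (by positivity : 0 < t ^ 2),
        abs_of_pos (by positivity : 0 < t + 1 / 2)]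
      have h4 : t ^ 2 ≤ 9 / 4 := by nlinarith [hw.1, hw.2]
      have h5 : t + 1 / 2 ≤ 2 := by linarith [hw.2]
      calc _ ≤ 9 / 4 * (C / n ^ 2 * |t - 1|) +
            ((Nat.factorial 2 : ℕ) / (β * n) ^ 2) * (|t - 1| * 2) := by gcongr
        _ = _ := by simp [Nat.factorial]; field_simp; ring
    rw [regularPart, indicator_of_mem hw, abs_div]
    have h6 : |(n : ℝ) * (1 - t ^ 2)| = n * (|t - 1| * (1 + t)) := by
      rw [abs_mul, abs_of_pos hn0, show (1 : ℝ) - t ^ 2 = -((t - 1) * (1 + t)) by ring, abs_neg,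
        abs_mul, abs_of_pos (by positivity : 0 < 1 + t)]
    rw [h6, div_mul_eq_mul_div, div_le_iff₀ (by positivity)]
    calc _ ≤ (9 / 4 * C + 4 / β ^ 2) / n ^ 2 * |t - 1| * (n ^ 2 * 4) := by
          gcongr
          nlinarith [hw.1, hw.2]
      _ = 4 * (9 / 4 * C + 4 / β ^ 2) * (1 * (|t - 1| * 1)) := by field_simp
      _ ≤ (4 * (9 / 4 * C + 4 / β ^ 2) + 6 / β ^ 2) * (n * (|t - 1| * (1 + t))) := by
          gcongr
          · have : 0 < 6 / β ^ 2 := by positivity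
            linarith
          · linarith
  · have h1 := bose_le hβ (by positivity : 0 < (n : ℝ) * t) two_ne_zero
    have hp := bose_pos hβ (by positivity : 0 < (n : ℝ) * t)
    have h2 : 5 / 13 * (1 + t ^ 2) ≤ |1 - t ^ 2| := by
      simp only [mem_Ioo, not_and_or, not_lt] at hw
      rcases hw with h | h
      · refine le_trans ?_ (le_abs_self _)
        nlinarith
      · refine le_trans ?_ (neg_le_abs _)
        nlinarith
    have h3 : 0 < |1 - t ^ 2| := lt_of_lt_of_le (by positivity) h2
    rw [regularPart, indicator_of_notMem hw, sub_zero, abs_div, abs_mul, abs_mul, abs_of_pos hn0,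
      abs_of_pos hp, abs_of_pos (by positivity : 0 < t ^ 2), div_mul_eq_mul_div,
      div_le_iff₀ (by positivity)]
    calc _ ≤ t ^ 2 * ((Nat.factorial 2 : ℕ) / (β * (n * t)) ^ 2) *
            (n ^ 2 * (13 / 5 * |1 - t ^ 2|)) := by
          gcongr
          linarith
      _ = 26 / 5 / β ^ 2 * (1 * |1 - t ^ 2|) := by simp [Nat.factorial]; field_simp; norm_num
      _ ≤ _ := by
          gcongr
          have : 0 < 1 / β ^ 2 := by positivity
          have e6 : 6 / β ^ 2 = 6 * (1 / β ^ 2) := by ring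
          have e5 : 26 / 5 / β ^ 2 = 26 / 5 * (1 / β ^ 2) := by ring
          have : 0 ≤ 4 * (9 / 4 * C + 4 / β ^ 2) := by positivity
          rw [e5, e6]
          linarith

lemma measurable_regularPart (n : ℕ+) : Measurable (regularPart β n) := by
  unfold regularPart
  refine Measurable.div ?_ (by fun_prop)
  refine Measurable.sub ?_ (Measurable.indicator (by fun_prop) measurableSet_Ioo)
  exact (by fun_prop : Measurable fun t : ℝ => t ^ 2).mul
    (measurable_bose.comp (by fun_prop))

lemma integrableOn_regularPart (hβ : 0 < β) (n : ℕ+) :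
    IntegrableOn (regularPart β n) (Ioi 0) := by
  obtain ⟨C, hC, h⟩ := exists_abs_regularPart_le hβ
  refine Integrable.mono' ((integrable_inv_one_add_sq.const_mul (C / n ^ 2)).integrableOn)
    (measurable_regularPart n).aestronglyMeasurable ?_
  filter_upwards [ae_restrict_mem measurableSet_Ioi,
    ae_restrict_of_ae (Measure.ae_ne volume 1)] with t ht ht1 using h n t ht ht1

lemma exists_integral_abs_regularPart_le (hβ : 0 < β) :
    ∃ C, ∀ n : ℕ+, ∫ t in Ioi (0 : ℝ), |regularPart β n t| ≤ C * (1 / (n : ℝ) ^ 2) := by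
  obtain ⟨C, hC, h⟩ := exists_abs_regularPart_le hβ
  refine ⟨C * ∫ t in Ioi (0 : ℝ), (1 + t ^ 2)⁻¹, fun n => ?_⟩
  have : C * (∫ t in Ioi (0 : ℝ), (1 + t ^ 2)⁻¹) * (1 / (n : ℝ) ^ 2) =
      ∫ t in Ioi (0 : ℝ), C / n ^ 2 * (1 + t ^ 2)⁻¹ := by
    rw [integral_const_mul]; ring
  rw [this]
  refine integral_mono_ae (integrableOn_regularPart hβ n).abs
    ((integrable_inv_one_add_sq.const_mul (C / n ^ 2)).integrableOn) ?_
  filter_upwards [ae_restrict_mem measurableSet_Ioi,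
    ae_restrict_of_ae (Measure.ae_ne volume 1)] with t ht ht1 using h n t ht ht1

/-! ### Principal value of a single mode -/

/-- The principal value of `∫_0^∞ sin(2πnξt) t² / (n (e^{βnt} - 1) (1 - t²)) dt`, given by the
formula that results from splitting off the pole (see `tendsto_truncatedIntegral_mode`). -/
noncomputable def modePV (β ξ : ℝ) (n : ℕ+) : ℝ :=
  (∫ t in Ioi (0 : ℝ), sin (2 * π * (n * ξ) * t) * regularPart β n t) -
    bose β n / n * cos (2 * π * (n * ξ)) * windowSine (n * ξ)

lemma sin_reflection (A : ℝ) {v : ℝ} (hv : v ≠ 0) :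
    (sin (A * (1 - v)) - sin (A * (1 + v))) / (2 * v) = -(cos A * (A * sinc (A * v))) := by
  rw [mul_sinc_mul A hv, Real.sin_sub_sin,
    show (A * (1 - v) - A * (1 + v)) / 2 = -(A * v) by ring,
    show (A * (1 - v) + A * (1 + v)) / 2 = A by ring, Real.sin_neg]
  field_simp

lemma integrableOn_sin_mul {f : ℝ → ℝ} (hf : IntegrableOn f (Ioi 0)) (a : ℝ) :
    IntegrableOn (fun t => sin (a * t) * f t) (Ioi 0) :=
  hf.bdd_mul (c := 1) (by fun_prop)
      (Eventually.of_forall fun u => by simpa using abs_sin_le_one _)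

lemma regularPart_add_window (n : ℕ+) {t : ℝ} (ht1 : t ≠ 1) (ht : 0 < t) (s : ℝ) :
    s * (t ^ 2 * bose β (n * t) / (n * (1 - t ^ 2))) = s * regularPart β n t +
      (Ioo (1 / 2) (3 / 2)).indicator (fun t => bose β n / n * s / (2 * (1 - t))) t := by
  have hn := (pnat_cast_pos n).ne'
  have h1 : 1 - t ≠ 0 := sub_ne_zero.mpr ht1.symm
  have h2 : 1 - t ^ 2 = (1 - t) * (1 + t) := by ring
  have h3 : 1 + t ≠ 0 := by positivity
  rw [regularPart, h2]
  by_cases hw : t ∈ Ioo (1 / 2 : ℝ) (3 / 2)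
  · rw [indicator_of_mem hw, indicator_of_mem hw]
    field_simp
    ring
  · rw [indicator_of_notMem hw, indicator_of_notMem hw]
    ring

lemma tendsto_truncatedIntegral_mode (hβ : 0 < β) (ξ : ℝ) (n : ℕ+) :
    (∀ ε : ℝ, 0 < ε → IntegrableOn (fun t => sin (2 * π * (n * ξ) * t) *
      (t ^ 2 * bose β (n * t) / (n * (1 - t ^ 2)))) (Ioo 0 (1 - ε))) ∧
    (∀ ε : ℝ, 0 < ε → IntegrableOn (fun t => sin (2 * π * (n * ξ) * t) *
      (t ^ 2 * bose β (n * t) / (n * (1 - t ^ 2)))) (Ioi (1 + ε))) ∧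
    Tendsto (truncatedIntegral fun t => sin (2 * π * (n * ξ) * t) *
      (t ^ 2 * bose β (n * t) / (n * (1 - t ^ 2)))) (𝓝[>] 0) (𝓝 (modePV β ξ n)) := by
  have hs := continuous_sinc
  have h := truncatedIntegral_of_decomposition
    (f := fun t => sin (2 * π * (n * ξ) * t) * (t ^ 2 * bose β (n * t) / (n * (1 - t ^ 2))))
    (P := fun t => bose β n / n * sin (2 * π * (n * ξ) * t))
    (Q := fun v => -(bose β n / n * cos (2 * π * (n * ξ)) *
      (2 * π * (n * ξ) * sinc (2 * π * (n * ξ) * v))))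
    (integrableOn_sin_mul (integrableOn_regularPart hβ n) (2 * π * (n * ξ))) (by fun_prop)
    (by fun_prop) (fun v hv => ?_) (fun t ht ht1 => ?_)
  · convert! h using 4
    rw [modePV, intervalIntegral.integral_neg, intervalIntegral.integral_const_mul,
      sub_eq_add_neg, windowSine]
  · rw [← mul_sub, mul_div_assoc, sin_reflection _ hv]
    ring
  · rw [regularPart_add_window n ht1 ht]
    congr 1

lemma truncatedIntegral_sub {f g : ℝ → ℝ} {ε : ℝ}
    (hf : IntegrableOn f (Ioo 0 (1 - ε)) ∧ IntegrableOn f (Ioi (1 + ε)))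
    (hg : IntegrableOn g (Ioo 0 (1 - ε)) ∧ IntegrableOn g (Ioi (1 + ε))) :
    truncatedIntegral f ε - truncatedIntegral g ε = truncatedIntegral (fun t => f t - g t) ε := by
  rw [truncatedIntegral, truncatedIntegral, truncatedIntegral, integral_sub hf.1 hg.1,
    integral_sub hf.2 hg.2]
  ring

/-- The increment of `sin(2πnξt)` in `ξ` by `1` vanishes at `t = 1`, because `n` is an integer;
this factors out the zero. -/
lemma sin_sub_sin_eq_integral (n : ℕ+) {t : ℝ} (ht : 0 < t) (ht1 : t ≠ 1) (ξ : ℝ) :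
    sin (2 * π * (n * (ξ + 1)) * t) - sin (2 * π * (n * ξ) * t) =
      -((2 * π * n * (1 - t ^ 2) / t) *
        ∫ r in (0 : ℝ)..1, cos (2 * π * n * r) * cos (2 * π * (ξ + r) * (n * t))) := by
  have hn := pnat_cast_pos n
  have h1 : t ^ 2 - 1 ≠ 0 := fun h => one_sub_sq_ne_zero ht ht1 (by linarith)
  -- an antiderivative of the product of cosines
  have hderiv : ∀ r ∈ uIcc (0 : ℝ) 1, HasDerivAt (fun r =>
      (t * cos (2 * π * n * r) * sin (2 * π * (ξ + r) * (n * t)) -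
        sin (2 * π * n * r) * cos (2 * π * (ξ + r) * (n * t))) / (2 * π * n * (t ^ 2 - 1)))
      (cos (2 * π * n * r) * cos (2 * π * (ξ + r) * (n * t))) r := by
    intro r _
    have d1 : HasDerivAt (fun r : ℝ => 2 * π * n * r) (2 * π * n) r := by
      simpa using (hasDerivAt_id r).const_mul (2 * π * n)
    have d2 : HasDerivAt (fun r : ℝ => 2 * π * (ξ + r) * (n * t)) (2 * π * (n * t)) r := by
      simpa using (((hasDerivAt_id r).const_add ξ).const_mul (2 * π)).mul_const (n * t)
    convert! ((((d1.cos).const_mul t).mul d2.sin).sub (d1.sin.mul d2.cos)).div_const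
      (2 * π * n * (t ^ 2 - 1)) using 1
    rw [eq_div_iff (by positivity)]
    ring
  rw [intervalIntegral.integral_eq_sub_of_hasDerivAt hderiv
    (Continuous.intervalIntegrable (by fun_prop) _ _)]
  have c1 : cos (2 * π * n * 1) = 1 := by
    rw [mul_one, mul_comm]; exact_mod_cast Real.cos_nat_mul_two_pi n
  have s1 : sin (2 * π * n * 1) = 0 := by
    have := Real.sin_nat_mul_pi (2 * n)
    rw [← this]; push_cast; ring_nf
  rw [c1, s1, mul_zero, Real.cos_zero, Real.sin_zero, add_zero]
  rw [show 2 * π * (n * (ξ + 1)) * t = 2 * π * (ξ + 1) * (n * t) by ring,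
    show 2 * π * (n * ξ) * t = 2 * π * ξ * (n * t) by ring]
  field_simp
  ring

lemma integral_mul_cos_mul_bose_comp (n : ℕ+) (ξ : ℝ) :
    ∫ t in Ioi (0 : ℝ), 2 * π * t * bose β (n * t) * cos (2 * π * ξ * (n * t)) =
      1 / (n : ℝ) ^ 2 * boseSineDeriv β ξ := by
  have hn := pnat_cast_pos n
  have h := integral_comp_mul_left_Ioi
    (fun u => 2 * π * u * cos (2 * π * ξ * u) * bose β u) 0 hn
  rw [mul_zero, smul_eq_mul] at h
  have e : (1 : ℝ) / n ^ 2 = (n : ℝ)⁻¹ * (n : ℝ)⁻¹ := by field_simp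
  rw [boseSineDeriv, e, mul_assoc (n : ℝ)⁻¹, ← h, ← integral_const_mul]
  congr 1
  ext t
  field_simp

lemma integrableOn_mul_bose_comp (hβ : 0 < β) (n : ℕ+) :
    IntegrableOn (fun t => t * bose β (n * t)) (Ioi 0) := by
  have hn := pnat_cast_pos n
  have := (integrableOn_Ioi_comp_mul_left_iff (fun u => u * bose β u) 0 hn).mpr
    (by rw [mul_zero]; exact integrableOn_mul_bose hβ)
  refine (this.const_mul (n : ℝ)⁻¹).congr (Eventually.of_forall fun t => ?_)
  simp only
  field_simp

/-- Shifting `ξ` by `1` changes the `n`-th principal value by a Fourier coefficient of the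
derivative of the sine transform. -/
lemma modePV_add_one_sub (hβ : 0 < β) (ξ : ℝ) (n : ℕ+) :
    modePV β (ξ + 1) n - modePV β ξ n =
      -(1 / (n : ℝ) ^ 2 * ∫ r in (0 : ℝ)..1, cos (2 * π * n * r) * boseSineDeriv β (ξ + r)) := by
  have hn := pnat_cast_pos n
  -- `g` is the difference of the two integrands off `t = 1`; it has no pole left
  set g : ℝ → ℝ := fun t => -∫ r in (0 : ℝ)..1,
    cos (2 * π * n * r) * (2 * π * t * bose β (n * t) * cos (2 * π * (ξ + r) * (n * t))) with hg
  obtain ⟨hL, hR, ht⟩ := tendsto_truncatedIntegral_mode hβ ξ n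
  obtain ⟨hL', hR', ht'⟩ := tendsto_truncatedIntegral_mode hβ (ξ + 1) n
  have hbase : IntegrableOn (fun t => 2 * π * t * bose β (n * t)) (Ioi 0) :=
    ((integrableOn_mul_bose_comp hβ n).const_mul (2 * π)).congr
      (Eventually.of_forall fun t => (mul_assoc _ _ _).symm)
  -- absolute integrability on `(0, ∞) × (0, 1]`
  have hprod : Integrable (Function.uncurry fun (t r : ℝ) =>
      cos (2 * π * n * r) * (2 * π * t * bose β (n * t) * cos (2 * π * (ξ + r) * (n * t))))
      ((volume.restrict (Ioi 0)).prod (volume.restrict (Ioc 0 1))) := by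
    have h1 : Integrable (fun p : ℝ × ℝ => 2 * π * p.1 * bose β (n * p.1) * 1)
      ((volume.restrict (Ioi 0)).prod (volume.restrict (Ioc 0 1))) :=
      hbase.mul_prod (integrable_const 1)
    refine (h1.bdd_mul (f := fun p : ℝ × ℝ =>
      cos (2 * π * n * p.2) * cos (2 * π * (ξ + p.2) * (n * p.1))) (c := 1) (by fun_prop)
      (Eventually.of_forall fun p => ?_)).congr (Eventually.of_forall fun p => ?_)
    · rw [norm_mul, Real.norm_eq_abs, Real.norm_eq_abs]
      exact mul_le_one₀ (abs_cos_le_one _) (abs_nonneg _) (abs_cos_le_one _)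
    · simp only [Function.uncurry]; ring
  have hgi : IntegrableOn g (Ioi 0) := by
    have := hprod.integral_prod_left.neg
    refine this.congr (Eventually.of_forall fun t => ?_)
    simp only [hg, Function.uncurry, Pi.neg_apply]
    rw [intervalIntegral.integral_of_le zero_le_one]
  have h0 := (truncatedIntegral_of_decomposition (f := fun t => sin (2 * π * (n * (ξ + 1)) * t) *
      (t ^ 2 * bose β (n * t) / (n * (1 - t ^ 2))) - sin (2 * π * (n * ξ) * t) *
      (t ^ 2 * bose β (n * t) / (n * (1 - t ^ 2)))) (P := fun _ => 0) (Q := fun _ => 0) hgi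
      continuous_const continuous_const (fun v _ => by simp) (fun t ht ht1 => ?_)).2.2
  · have hsub := ht'.sub ht
    -- the principal value of an integrable function is its integral
    have huniq := tendsto_nhds_unique hsub (h0.congr' ?_)
    · rw [huniq, intervalIntegral.integral_zero, add_zero, hg, integral_neg]
      congr 1
      simp_rw [intervalIntegral.integral_of_le (zero_le_one' ℝ)]
      rw [integral_integral_swap hprod, ← integral_const_mul]
      congr 1
      ext r
      rw [integral_const_mul, integral_mul_cos_mul_bose_comp]
      ring
    · filter_upwards [self_mem_nhdsWithin] with ε hε
      exact (truncatedIntegral_sub ⟨hL' ε hε, hR' ε hε⟩ ⟨hL ε hε, hR ε hε⟩).symm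
  · have h1 := one_sub_sq_ne_zero ht ht1
    rw [← sub_mul, sin_sub_sin_eq_integral n ht ht1]
    simp only [hg, zero_div, indicator_zero, add_zero]
    have : ∀ r, cos (2 * π * n * r) *
      (2 * π * t * bose β (n * t) * cos (2 * π * (ξ + r) * (n * t))) =
      (2 * π * t * bose β (n * t)) * (cos (2 * π * n * r) * cos (2 * π * (ξ + r) * (n * t))) := by
      intro r; ring
    simp_rw [this]
    rw [intervalIntegral.integral_const_mul]
    field_simp

/-! ### Principal value of the whole series -/

/-- A series of integrable functions whose `L¹` norms are summable has an integrable sum. -/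
lemma integrable_tsum_of_summable_integral_norm {Ω ι : Type*} [MeasurableSpace Ω] [Countable ι]
    {μ : Measure Ω} {F : ι → Ω → ℝ} (hF : ∀ i, Integrable (F i) μ)
    (hsum : Summable fun i => ∫ a, ‖F i a‖ ∂μ) : Integrable (fun a => ∑' i, F i a) μ := by
  have hfin : ∑' i, ∫⁻ a, ‖F i a‖ₑ ∂μ ≠ ⊤ := by
    have (i : ι) : ∫⁻ a, ‖F i a‖ₑ ∂μ = ENNReal.ofReal (∫ a, ‖F i a‖ ∂μ) :=
      (ofReal_integral_norm_eq_lintegral_enorm (hF i)).symm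
    simp_rw [this]
    exact hsum.tsum_ofReal_ne_top
  refine ⟨AEStronglyMeasurable.tsum fun i => (hF i).1, ?_⟩
  rw [← lintegral_tsum fun i => (hF i).1.enorm] at hfin
  refine lt_of_le_of_lt (lintegral_mono fun a => ?_) (lt_top_iff_ne_top.mpr hfin)
  exact enorm_tsum_le_tsum_enorm

/-- The terms `sin(2πnξt) / (n (e^{βnt} - 1))` of the series under the singular integral. -/
noncomputable def sineTerm (β ξ t : ℝ) (n : ℕ+) : ℝ :=
  sin (2 * π * (n * ξ) * t) * (bose β (n * t) / n)

lemma bose_div_le (hβ : 0 < β) {t : ℝ} (ht : 0 < t) (n : ℕ+) :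
    bose β (n * t) / n ≤ bose β (n * t) := by
  have hn := one_le_pnat_cast n
  exact div_le_self (bose_pos hβ (by positivity)).le hn

lemma bose_mul_le (hβ : 0 < β) {a t : ℝ} (ha : 0 < a) (hat : a ≤ t) (n : ℕ+) :
    bose β (n * t) ≤ 2 / (β * a) ^ 2 * (1 / (n : ℝ) ^ 2) := by
  have hn := pnat_cast_pos n
  have h := bose_le hβ (by positivity : 0 < (n : ℝ) * a) two_ne_zero
  calc bose β (n * t) ≤ bose β (n * a) := bose_anti hβ (by positivity) (by gcongr)
    _ ≤ _ := h
    _ = _ := by simp [Nat.factorial]; field_simp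

lemma abs_sineTerm_le (hβ : 0 < β) (ξ : ℝ) {a t : ℝ} (ha : 0 < a) (hat : a ≤ t) (n : ℕ+) :
    |sineTerm β ξ t n| ≤ 2 / (β * a) ^ 2 * (1 / (n : ℝ) ^ 2) := by
  have hn := pnat_cast_pos n
  have ht := ha.trans_le hat
  have hp := bose_pos hβ (by positivity : 0 < (n : ℝ) * t)
  rw [sineTerm, abs_mul, abs_of_pos (by positivity : 0 < bose β (n * t) / n)]
  calc _ ≤ 1 * (bose β (n * t) / n) := by gcongr; exact abs_sin_le_one _
    _ ≤ bose β (n * t) := by rw [one_mul]; exact bose_div_le hβ ht n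
    _ ≤ _ := bose_mul_le hβ ha hat n

lemma summable_sineTerm (hβ : 0 < β) (ξ : ℝ) {t : ℝ} (ht : 0 < t) : Summable (sineTerm β ξ t) :=
  Summable.of_norm_bounded (summable_one_div_pnat_sq.mul_left _)
    (abs_sineTerm_le hβ ξ ht le_rfl)

lemma continuousOn_tsum_sineTerm (hβ : 0 < β) (ξ : ℝ) :
    ContinuousOn (fun t => ∑' n, sineTerm β ξ t n) (Ioi 0) := by
  intro t ht
  have ht : 0 < t := ht
  have h : ContinuousOn (fun t => ∑' n, sineTerm β ξ t n) (Ioi (t / 2)) := by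
    refine continuousOn_tsum (fun n => ?_) (summable_one_div_pnat_sq.mul_left _)
      fun n s hs => abs_sineTerm_le hβ ξ (half_pos ht) (le_of_lt hs) n
    unfold sineTerm
    refine ContinuousOn.mul (by fun_prop) (ContinuousOn.div_const ?_ _)
    refine (continuousOn_bose hβ).comp (by fun_prop) fun s hs => ?_
    have hs : t / 2 < s := hs
    exact mul_pos (pnat_cast_pos n) (by linarith)
  exact (h.continuousAt (Ioi_mem_nhds (half_lt_self ht))).continuousWithinAt

lemma integral_mul_bose_comp (n : ℕ+) :
    ∫ t in Ioi (0 : ℝ), t * bose β (n * t) =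
      1 / (n : ℝ) ^ 2 * ∫ u in Ioi (0 : ℝ), u * bose β u := by
  have hn := pnat_cast_pos n
  have h := integral_comp_mul_left_Ioi (fun u => u * bose β u) 0 hn
  rw [mul_zero, smul_eq_mul] at h
  have e : (1 : ℝ) / n ^ 2 = (n : ℝ)⁻¹ * (n : ℝ)⁻¹ := by field_simp
  rw [e, mul_assoc (n : ℝ)⁻¹, ← h, ← integral_const_mul]
  congr 1
  ext t
  field_simp

lemma integral_sineTerm (β ξ : ℝ) (n : ℕ+) :
    ∫ t in Ioi (0 : ℝ), sineTerm β ξ t n = 1 / (n : ℝ) ^ 2 * boseSine β ξ := by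
  have hn := pnat_cast_pos n
  have h := integral_comp_mul_left_Ioi (fun u => sin (2 * π * ξ * u) * bose β u) 0 hn
  rw [mul_zero, smul_eq_mul] at h
  have e : (1 : ℝ) / n ^ 2 = (n : ℝ)⁻¹ * (n : ℝ)⁻¹ := by field_simp
  rw [boseSine, e, mul_assoc (n : ℝ)⁻¹, ← h, ← integral_const_mul]
  congr 1
  ext t
  rw [sineTerm, show 2 * π * (n * ξ) * t = 2 * π * ξ * (n * t) by ring]
  field_simp

lemma abs_sineTerm_le_mul (hβ : 0 < β) (ξ : ℝ) {t : ℝ} (ht : 0 < t) (n : ℕ+) :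
    |sineTerm β ξ t n| ≤ 2 * π * |ξ| * (t * bose β (n * t)) := by
  have hn := pnat_cast_pos n
  have hp := bose_pos hβ (by positivity : 0 < (n : ℝ) * t)
  rw [sineTerm, abs_mul, abs_of_pos (by positivity : 0 < bose β (n * t) / n)]
  calc _ ≤ |2 * π * (n * ξ)| * t * (bose β (n * t) / n) := by
        gcongr; exact abs_sin_mul_le _ ht
    _ = _ := by
        rw [abs_mul (2 * π), abs_mul (n : ℝ), abs_of_pos hn, abs_of_pos two_pi_pos]
        field_simp

lemma integrableOn_sineTerm (hβ : 0 < β) (ξ : ℝ) (n : ℕ+) :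
    IntegrableOn (fun t => sineTerm β ξ t n) (Ioi 0) := by
  refine Integrable.mono' ((integrableOn_mul_bose_comp hβ n).const_mul (2 * π * |ξ|)) ?_ ?_
  · refine Measurable.aestronglyMeasurable ?_
    unfold sineTerm
    exact (by fun_prop : Measurable fun t : ℝ => sin (2 * π * (n * ξ) * t)).mul
      ((measurable_bose.comp (by fun_prop)).div_const _)
  · filter_upwards [ae_restrict_mem measurableSet_Ioi] with t ht using
      abs_sineTerm_le_mul hβ ξ ht n

lemma summable_integral_norm_sineTerm (hβ : 0 < β) (ξ : ℝ) :
    Summable fun n : ℕ+ => ∫ t in Ioi (0 : ℝ), ‖sineTerm β ξ t n‖ := by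
  refine Summable.of_nonneg_of_le (fun n => integral_nonneg fun t => norm_nonneg (sineTerm β ξ t n))
    (fun n => ?_)
    (summable_one_div_pnat_sq.mul_right (2 * π * |ξ| * ∫ u in Ioi (0 : ℝ), u * bose β u))
  calc _ ≤ ∫ t in Ioi (0 : ℝ), 2 * π * |ξ| * (t * bose β (n * t)) :=
        setIntegral_mono_on (integrableOn_sineTerm hβ ξ n).norm
          ((integrableOn_mul_bose_comp hβ n).const_mul _) measurableSet_Ioi
          fun t ht => abs_sineTerm_le_mul hβ ξ ht n
    _ = _ := by rw [integral_const_mul, integral_mul_bose_comp]; ring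

lemma summable_integral_norm_sin_mul_regularPart (hβ : 0 < β) (a : ℕ+ → ℝ) :
    Summable fun n : ℕ+ => ∫ t in Ioi (0 : ℝ), ‖sin (a n * t) * regularPart β n t‖ := by
  obtain ⟨C, hC⟩ := exists_integral_abs_regularPart_le hβ
  refine Summable.of_nonneg_of_le
    (fun n => integral_nonneg fun t => norm_nonneg (sin (a n * t) * regularPart β n t))
    (fun n => ?_) (summable_one_div_pnat_sq.mul_left C)
  refine le_trans (integral_mono (integrableOn_sin_mul (integrableOn_regularPart hβ n) _).norm
    (integrableOn_regularPart hβ n).abs fun t => ?_) (hC n)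
  rw [norm_mul, Real.norm_eq_abs, Real.norm_eq_abs]
  exact mul_le_of_le_one_left (abs_nonneg _) (abs_sin_le_one _)

lemma hasSum_one_div_pnat_sq : HasSum (fun n : ℕ+ => 1 / (n : ℝ) ^ 2) (π ^ 2 / 6) := by
  have h := summable_one_div_pnat_sq.hasSum
  rw [tsum_pnat_eq_tsum_succ (f := fun n : ℕ => 1 / (n : ℝ) ^ 2)] at h
  convert h using 1
  have h2 := (hasSum_nat_add_iff' 1).mpr hasSum_zeta_two
  rw [h2.tsum_eq]
  simp

/-- The coefficient of `1 / (2 (1 - t))` that is split off, summed over all `n`; it is the series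
of `sineTerm` with the weights frozen at `t = 1`. -/
noncomputable def windowAmplitude (β ξ t : ℝ) : ℝ :=
  ∑' n : ℕ+, bose β n / n * sin (2 * π * (n * ξ) * t)

lemma bose_natCast_le (hβ : 0 < β) (n : ℕ+) :
    bose β n ≤ 2 / β ^ 2 * (1 / (n : ℝ) ^ 2) := by
  simpa using bose_mul_le hβ one_pos le_rfl n

lemma abs_windowTerm_le (hβ : 0 < β) (n : ℕ+) {x : ℝ} (hx : |x| ≤ 1) :
    |bose β n / n * x| ≤ 2 / β ^ 2 * (1 / (n : ℝ) ^ 2) := by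
  have hn := pnat_cast_pos n
  have hp := bose_pos hβ hn
  rw [abs_mul, abs_of_pos (by positivity : 0 < bose β n / n)]
  refine (mul_le_of_le_one_right (by positivity) hx).trans ?_
  refine (div_le_self hp.le (one_le_pnat_cast n)).trans (bose_natCast_le hβ n)

lemma summable_windowTerm (hβ : 0 < β) {x : ℕ+ → ℝ} (hx : ∀ n, |x n| ≤ 1) :
    Summable fun n : ℕ+ => bose β n / n * x n :=
  Summable.of_norm_bounded (summable_one_div_pnat_sq.mul_left _)
    fun n => abs_windowTerm_le hβ n (hx n)

lemma continuous_windowAmplitude (hβ : 0 < β) (ξ : ℝ) : Continuous (windowAmplitude β ξ) :=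
  continuous_tsum (fun n => by fun_prop) (summable_one_div_pnat_sq.mul_left _)
    fun n _ => abs_windowTerm_le hβ n (abs_sin_le_one _)

/-- The symmetric difference quotient at `1` of the `n`-th term of `windowAmplitude`, as a
continuous function of the distance `v` to `1`. -/
noncomputable def windowQuotient (β ξ : ℝ) (n : ℕ+) (v : ℝ) : ℝ :=
  -(bose β n / n * cos (2 * π * (n * ξ)) * (2 * π * (n * ξ) * sinc (2 * π * (n * ξ) * v)))

lemma abs_windowQuotient_le (hβ : 0 < β) (ξ : ℝ) (n : ℕ+) (v : ℝ) :
    |windowQuotient β ξ n v| ≤ 2 * π * |ξ| * (2 / β ^ 2) * (1 / (n : ℝ) ^ 2) := by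
  have hn := pnat_cast_pos n
  have hp := bose_pos hβ hn
  have e : windowQuotient β ξ n v = -(2 * π * ξ * (bose β n) * (cos (2 * π * (n * ξ)) *
      sinc (2 * π * (n * ξ) * v))) := by
    unfold windowQuotient; field_simp
  have h1 : |cos (2 * π * (n * ξ)) * sinc (2 * π * (n * ξ) * v)| ≤ 1 := by
    rw [abs_mul]
    exact mul_le_one₀ (abs_cos_le_one _) (abs_nonneg _) (abs_sinc_le_one _)
  rw [e, abs_neg, abs_mul]
  refine (mul_le_of_le_one_right (abs_nonneg _) h1).trans ?_
  rw [abs_mul, abs_mul, abs_of_pos two_pi_pos, abs_of_pos hp, mul_assoc (2 * π * |ξ|)]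
  gcongr
  exact bose_natCast_le hβ n

lemma continuous_windowQuotient (ξ : ℝ) (n : ℕ+) : Continuous (windowQuotient β ξ n) := by
  have := continuous_sinc
  unfold windowQuotient
  fun_prop

lemma hasSum_integral_windowQuotient (hβ : 0 < β) (ξ : ℝ) :
    HasSum (fun n : ℕ+ => ∫ v in (0 : ℝ)..(1 / 2), windowQuotient β ξ n v)
    (∫ v in (0 : ℝ)..(1 / 2), ∑' n, windowQuotient β ξ n v) := by
  refine intervalIntegral.hasSum_integral_of_dominated_convergence
    (fun n _ => 2 * π * |ξ| * (2 / β ^ 2) * (1 / (n : ℝ) ^ 2))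
    (fun n => (continuous_windowQuotient ξ n).aestronglyMeasurable)
    (fun n => Eventually.of_forall fun v _ => abs_windowQuotient_le hβ ξ n v)
    (Eventually.of_forall fun v _ => summable_one_div_pnat_sq.mul_left _)
    intervalIntegrable_const (Eventually.of_forall fun v _ => ?_)
  exact (Summable.of_norm_bounded (summable_one_div_pnat_sq.mul_left _)
    fun n => abs_windowQuotient_le hβ ξ n v).hasSum

lemma integral_windowQuotient (β ξ : ℝ) (n : ℕ+) :
    ∫ v in (0 : ℝ)..(1 / 2), windowQuotient β ξ n v =
      -(bose β n / n * cos (2 * π * (n * ξ)) * windowSine (n * ξ)) := by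
  simp only [windowQuotient]
  rw [intervalIntegral.integral_neg, intervalIntegral.integral_const_mul, windowSine]

lemma summable_modePV (hβ : 0 < β) (ξ : ℝ) : Summable (modePV β ξ) := by
  have s2 := hasSum_integral_of_summable_integral_norm
    (fun n : ℕ+ => integrableOn_sin_mul (integrableOn_regularPart hβ n) (2 * π * (n * ξ)))
    (summable_integral_norm_sin_mul_regularPart hβ (fun n : ℕ+ => 2 * π * (n * ξ)))
  refine (s2.summable.add (hasSum_integral_windowQuotient hβ ξ).summable).congr fun n => ?_
  rw [modePV, integral_windowQuotient, sub_eq_add_neg]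

/-- The principal value of the singular integral. Writing `1 / (1 - t²) = 1 + t² / (1 - t²)`, the
summand `1` yields the multiple `∑ 1/n² = π²/6` of the sine transform and removes the singularity
at `t = 0` from the rest. -/
lemma truncatedIntegral_sineTerm (hβ : 0 < β) (ξ : ℝ) :
    (∀ ε : ℝ, 0 < ε →
      IntegrableOn (fun t => (∑' n, sineTerm β ξ t n) * (1 / (1 - t ^ 2))) (Ioo 0 (1 - ε))) ∧
    (∀ ε : ℝ, 0 < ε →
      IntegrableOn (fun t => (∑' n, sineTerm β ξ t n) * (1 / (1 - t ^ 2))) (Ioi (1 + ε))) ∧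
    Tendsto (truncatedIntegral fun t => (∑' n, sineTerm β ξ t n) * (1 / (1 - t ^ 2))) (𝓝[>] 0)
      (𝓝 (π ^ 2 / 6 * boseSine β ξ + ∑' n, modePV β ξ n)) := by
  have i1 := integrable_tsum_of_summable_integral_norm (fun n => integrableOn_sineTerm hβ ξ n)
    (summable_integral_norm_sineTerm hβ ξ)
  have s1 := hasSum_integral_of_summable_integral_norm (fun n => integrableOn_sineTerm hβ ξ n)
    (summable_integral_norm_sineTerm hβ ξ)
  have i2 := integrable_tsum_of_summable_integral_norm
    (fun n : ℕ+ => integrableOn_sin_mul (integrableOn_regularPart hβ n) (2 * π * (n * ξ)))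
    (summable_integral_norm_sin_mul_regularPart hβ (fun n : ℕ+ => 2 * π * (n * ξ)))
  have s2 := hasSum_integral_of_summable_integral_norm
    (fun n : ℕ+ => integrableOn_sin_mul (integrableOn_regularPart hβ n) (2 * π * (n * ξ)))
    (summable_integral_norm_sin_mul_regularPart hβ (fun n : ℕ+ => 2 * π * (n * ξ)))
  have s3 := hasSum_integral_windowQuotient hβ ξ
  have hval : (∫ t in Ioi (0 : ℝ), ((∑' n, sineTerm β ξ t n) +
      ∑' n : ℕ+, sin (2 * π * (n * ξ) * t) * regularPart β n t)) +
      (∫ v in (0 : ℝ)..(1 / 2), ∑' n, windowQuotient β ξ n v) =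
      π ^ 2 / 6 * boseSine β ξ + ∑' n, modePV β ξ n := by
    rw [integral_add i1 i2, ← s1.tsum_eq]
    simp_rw [integral_sineTerm]
    rw [(hasSum_one_div_pnat_sq.mul_right (boseSine β ξ)).tsum_eq, add_assoc,
      ← (s2.add s3).tsum_eq]
    congr 2
    ext n
    rw [modePV, integral_windowQuotient, sub_eq_add_neg]
  rw [← hval]
  refine truncatedIntegral_of_decomposition (P := windowAmplitude β ξ) (i1.add i2)
    (continuous_windowAmplitude hβ ξ)
    (continuous_tsum (fun n => continuous_windowQuotient ξ n)
      (summable_one_div_pnat_sq.mul_left _) fun n v => abs_windowQuotient_le hβ ξ n v)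
    (fun v hv => ?_) (fun t ht ht1 => ?_)
  · rw [windowAmplitude, windowAmplitude,
      ← (summable_windowTerm hβ fun n => abs_sin_le_one _).tsum_sub
        (summable_windowTerm hβ fun n => abs_sin_le_one _), ← tsum_div_const]
    congr 1
    ext n
    rw [← mul_sub, mul_div_assoc, sin_reflection _ hv, windowQuotient]
    ring
  · have h1 := one_sub_sq_ne_zero ht ht1
    have hsp := summable_sineTerm hβ ξ ht
    have hterm : ∀ n : ℕ+, sin (2 * π * (n * ξ) * t) * regularPart β n t =
        t ^ 2 / (1 - t ^ 2) * sineTerm β ξ t n -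
        (Ioo (1 / 2) (3 / 2)).indicator (fun t => 1 / (2 * (1 - t))) t *
          (bose β n / n * sin (2 * π * (n * ξ) * t)) := by
      intro n
      have hn := (pnat_cast_pos n).ne'
      have h := regularPart_add_window (β := β) n ht1 ht (sin (2 * π * (n * ξ) * t))
      rw [sineTerm]
      by_cases hw : t ∈ Ioo (1 / 2 : ℝ) (3 / 2)
      · rw [indicator_of_mem hw] at h ⊢
        rw [← sub_eq_iff_eq_add] at h
        rw [← h]
        field_simp
      · rw [indicator_of_notMem hw] at h ⊢
        rw [← sub_eq_iff_eq_add] at h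
        rw [← h]
        field_simp
        ring
    simp_rw [hterm]
    rw [(hsp.mul_left _).tsum_sub ((summable_windowTerm hβ fun n => abs_sin_le_one _).mul_left _),
      tsum_mul_left, tsum_mul_left,
      show ∑' n : ℕ+, bose β n / n * sin (2 * π * (n * ξ) * t) = windowAmplitude β ξ t from rfl]
    by_cases hw : t ∈ Ioo (1 / 2 : ℝ) (3 / 2)
    · rw [indicator_of_mem hw, indicator_of_mem hw]
      have : 1 - t ≠ 0 := sub_ne_zero.mpr ht1.symm
      field_simp
      ring
    · rw [indicator_of_notMem hw, indicator_of_notMem hw]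
      field_simp
      ring

/-! ### Limit and increment of the principal value -/

/-- The principal value of `∫_0^∞ ∑ sin(2πnξt) / (n (e^{βnt} - 1)) dt / (1 - t²)`, as evaluated in
`truncatedIntegral_sineTerm`. -/
noncomputable def sinePV (β ξ : ℝ) : ℝ := π ^ 2 / 6 * boseSine β ξ + ∑' n, modePV β ξ n

lemma cos_two_pi_mul_add_nat (n : ℕ+) (ξ : ℝ) (N : ℕ) :
    cos (2 * π * (n * (ξ + N))) = cos (2 * π * (n * ξ)) := by
  have := Real.cos_add_nat_mul_two_pi (2 * π * (n * ξ)) (n * N)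
  rw [← this]
  push_cast
  ring_nf

lemma tendsto_modePV (hβ : 0 < β) (ξ : ℝ) (n : ℕ+) :
    Tendsto (fun N : ℕ => modePV β (ξ + N) n) atTop
      (𝓝 (-(π / 2) * (bose β n / n * cos (2 * π * (n * ξ))))) := by
  have hn := pnat_cast_pos n
  have ha : Tendsto (fun N : ℕ => (n : ℝ) * (ξ + N)) atTop atTop :=
    (tendsto_atTop_add_const_left _ ξ tendsto_natCast_atTop_atTop).const_mul_atTop hn
  have h1 := (tendsto_integral_sin_mul (integrableOn_regularPart hβ n)).comp ha
  have h2 := (tendsto_windowSine.comp ha).const_mul (bose β n / n * cos (2 * π * (n * ξ)))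
  convert! h1.sub h2 using 1
  · ext N
    simp only [Function.comp, modePV, cos_two_pi_mul_add_nat]
  · congr 1; ring

lemma tendsto_tsum_modePV (hβ : 0 < β) (ξ : ℝ) :
    Tendsto (fun N : ℕ => ∑' n, modePV β (ξ + N) n) atTop
      (𝓝 (-(π / 2) * ∑' n : ℕ+, bose β n / n * cos (2 * π * (n * ξ)))) := by
  obtain ⟨C, hC⟩ := exists_integral_abs_regularPart_le hβ
  rw [← tsum_mul_left]
  refine tendsto_tsum_of_dominated_convergence
    (bound := fun n : ℕ+ => (C + 2 / β ^ 2 * 3) * (1 / (n : ℝ) ^ 2))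
    (summable_one_div_pnat_sq.mul_left _) (fun n => tendsto_modePV hβ ξ n) ?_
  obtain ⟨A, hA⟩ := eventually_atTop.mp
    (tendsto_windowSine.eventually (Metric.ball_mem_nhds (π / 2) one_pos))
  have hlim : Tendsto (fun N : ℕ => ξ + (N : ℝ)) atTop atTop :=
    tendsto_atTop_add_const_left _ ξ tendsto_natCast_atTop_atTop
  filter_upwards [hlim.eventually_ge_atTop (max A 0)] with N hN n
  have hn := one_le_pnat_cast n
  have hN0 : 0 ≤ ξ + N := (le_max_right _ _).trans hN
  have hNA : A ≤ n * (ξ + N) := by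
    have : A ≤ ξ + N := (le_max_left _ _).trans hN
    nlinarith
  have hw : |windowSine (n * (ξ + N))| ≤ 3 := by
    have h := hA _ hNA
    rw [Real.dist_eq, abs_lt] at h
    have := Real.pi_le_four
    have := Real.pi_pos
    rw [abs_le]
    constructor <;> linarith [h.1, h.2]
  have h1 : |∫ t in Ioi (0 : ℝ), sin (2 * π * (n * (ξ + N)) * t) * regularPart β n t| ≤
      C * (1 / (n : ℝ) ^ 2) := by
    rw [← Real.norm_eq_abs]
    refine (norm_integral_le_integral_norm _).trans (le_trans ?_ (hC n))
    refine integral_mono (integrableOn_sin_mul (integrableOn_regularPart hβ n) _).norm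
      (integrableOn_regularPart hβ n).abs fun t => ?_
    rw [norm_mul, Real.norm_eq_abs, Real.norm_eq_abs]
    exact mul_le_of_le_one_left (abs_nonneg _) (abs_sin_le_one _)
  have h2 : |bose β n / n * cos (2 * π * (n * (ξ + N))) * windowSine (n * (ξ + N))| ≤
      2 / β ^ 2 * (1 / (n : ℝ) ^ 2) * 3 := by
    rw [abs_mul]
    have := abs_windowTerm_le hβ n (abs_cos_le_one (2 * π * (n * (ξ + N))))
    gcongr
  rw [modePV, Real.norm_eq_abs]
  refine (abs_sub _ _).trans ?_
  linarith

/-- Behaviour of the principal value as `ξ → ∞` along a class modulo `1`: the pole at `t = 0`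
contributes the constant, the poles at `t = 1` contribute the cosine series. -/
lemma tendsto_sinePV (hβ : 0 < β) (ξ : ℝ) :
    Tendsto (fun N : ℕ => sinePV β (ξ + N)) atTop
      (𝓝 (π ^ 2 / 6 * (π / (2 * β)) -
        π / 2 * ∑' n : ℕ+, bose β n / n * cos (2 * π * (n * ξ)))) := by
  have hlim : Tendsto (fun N : ℕ => ξ + (N : ℝ)) atTop atTop :=
    tendsto_atTop_add_const_left _ ξ tendsto_natCast_atTop_atTop
  rw [sub_eq_add_neg, ← neg_mul]
  exact (((tendsto_boseSine hβ).comp hlim).const_mul _).add (tendsto_tsum_modePV hβ ξ)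

/-- The Fourier series of the second Bernoulli polynomial. -/
lemma hasSum_cos_div_pnat_sq {r : ℝ} (hr : r ∈ Icc (0 : ℝ) 1) :
    HasSum (fun n : ℕ+ => 1 / (n : ℝ) ^ 2 * cos (2 * π * n * r)) (π ^ 2 * (r ^ 2 - r + 1 / 6)) := by
  have h := hasSum_one_div_nat_pow_mul_cos one_ne_zero hr
  simp only [mul_one] at h
  have hs : Summable fun n : ℕ+ => 1 / (n : ℝ) ^ 2 * cos (2 * π * n * r) :=
    h.summable.comp_injective PNat.coe_injective
  have h1 := hs.hasSum
  rw [tsum_pnat_eq_tsum_succ (f := fun n : ℕ => 1 / (n : ℝ) ^ 2 * cos (2 * π * n * r))] at h1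
  convert h1 using 1
  rw [((hasSum_nat_add_iff' 1).mpr h).tsum_eq]
  have := bernoulliFun_two r
  rw [bernoulliFun] at this
  have h0 : ∑ n ∈ Finset.range 1, 1 / (n : ℝ) ^ 2 * cos (2 * π * n * r) = 0 := by simp
  rw [this, h0, Nat.factorial_two]
  push_cast
  ring

lemma hasSum_integral_cos_mul_boseSineDeriv (hβ : 0 < β) (ξ : ℝ) :
    HasSum (fun n : ℕ+ => 1 / (n : ℝ) ^ 2 *
        ∫ r in (0 : ℝ)..1, cos (2 * π * n * r) * boseSineDeriv β (ξ + r))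
      (∫ r in (0 : ℝ)..1, π ^ 2 * (r ^ 2 - r + 1 / 6) * boseSineDeriv β (ξ + r)) := by
  have hc : Continuous fun r => boseSineDeriv β (ξ + r) :=
    (continuous_boseSineDeriv hβ).comp (by fun_prop)
  have h := intervalIntegral.hasSum_integral_of_dominated_convergence (μ := volume)
    (a := (0 : ℝ)) (b := 1) (f := fun r => π ^ 2 * (r ^ 2 - r + 1 / 6) * boseSineDeriv β (ξ + r))
    (F := fun (n : ℕ+) r => 1 / (n : ℝ) ^ 2 * cos (2 * π * n * r) * boseSineDeriv β (ξ + r))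
    (fun n r => 1 / (n : ℝ) ^ 2 * |boseSineDeriv β (ξ + r)|)
    (fun n => (by fun_prop : Continuous _).aestronglyMeasurable)
    (fun n => Eventually.of_forall fun r _ => ?_)
    (Eventually.of_forall fun r _ => summable_one_div_pnat_sq.mul_right _) ?_
    (Eventually.of_forall fun r hr => ?_)
  · convert! h using 1
    ext n
    rw [← intervalIntegral.integral_const_mul]
    simp only [mul_assoc]
  · rw [norm_mul, Real.norm_eq_abs, Real.norm_eq_abs, abs_mul,
      abs_of_pos (by have := pnat_cast_pos n; positivity : 0 < 1 / (n : ℝ) ^ 2)]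
    gcongr
    exact mul_le_of_le_one_right (by positivity) (abs_cos_le_one _)
  · simp_rw [tsum_mul_right]
    exact (hc.abs.const_mul _).intervalIntegrable _ _
  · rw [uIoc_of_le zero_le_one] at hr
    exact (hasSum_cos_div_pnat_sq ⟨hr.1.le, hr.2⟩).mul_right _

lemma sinePV_add_one_sub (hβ : 0 < β) (ξ : ℝ) :
    sinePV β (ξ + 1) - sinePV β ξ =
      π ^ 2 * ∫ r in (0 : ℝ)..1, (2 * r - 1) * boseSine β (ξ + r) := by
  have h1 : ∑' n, modePV β (ξ + 1) n - ∑' n, modePV β ξ n =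
      -∫ r in (0 : ℝ)..1, π ^ 2 * (r ^ 2 - r + 1 / 6) * boseSineDeriv β (ξ + r) := by
    rw [← (summable_modePV hβ (ξ + 1)).tsum_sub (summable_modePV hβ ξ),
      ← (hasSum_integral_cos_mul_boseSineDeriv hβ ξ).tsum_eq, ← tsum_neg]
    exact tsum_congr fun n => modePV_add_one_sub hβ ξ n
  have hu : ∀ r : ℝ, HasDerivAt (fun r => π ^ 2 * (r ^ 2 - r + 1 / 6)) (π ^ 2 * (2 * r - 1)) r := by
    intro r
    have := (((hasDerivAt_pow 2 r).sub (hasDerivAt_id r)).add_const (1 / 6)).const_mul (π ^ 2)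
    simpa using this
  have hv : ∀ r : ℝ, HasDerivAt (fun r => boseSine β (ξ + r)) (boseSineDeriv β (ξ + r)) r := by
    intro r
    simpa using (hasDerivAt_boseSine hβ (ξ + r)).comp_const_add ξ r
  have hc : Continuous fun r => boseSineDeriv β (ξ + r) :=
    (continuous_boseSineDeriv hβ).comp (by fun_prop)
  -- integration by parts; the value `1/6` of the polynomial at both ends cancels the multiple
  -- `π²/6` of the sine transform in `sinePV`
  have hparts := intervalIntegral.integral_mul_deriv_eq_deriv_mul (a := 0) (b := 1)
    (fun r _ => hu r) (fun r _ => hv r)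
    (Continuous.intervalIntegrable (by fun_prop) _ _) (hc.intervalIntegrable _ _)
  rw [hparts] at h1
  simp_rw [mul_assoc (π ^ 2)] at h1
  rw [intervalIntegral.integral_const_mul] at h1
  rw [sinePV, sinePV]
  norm_num at h1
  linarith

/-! ### The elementary terms -/

lemma expQuotient_eq_dslope (α : ℝ) :
    expQuotient α = dslope (fun x => 1 - exp (-2 * π * x * α)) 0 := by
  have hd : HasDerivAt (fun x => 1 - exp (-2 * π * x * α)) (2 * π * α) 0 := by
    have h1 : HasDerivAt (fun x : ℝ => -2 * π * x * α) (-2 * π * α) 0 := by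
      simpa using ((hasDerivAt_id (0 : ℝ)).const_mul (-2 * π)).mul_const α
    convert! h1.exp.const_sub 1 using 1
    simp
  ext ξ
  rcases eq_or_ne ξ 0 with rfl | h
  · rw [dslope_same, hd.deriv, expQuotient, if_pos rfl]
  · rw [dslope_of_ne _ h, slope_def_field, expQuotient, if_neg h]
    simp

lemma exp_neg_form (α ξ : ℝ) : exp (-2 * π * ξ * α) = (exp (2 * π * α * ξ))⁻¹ := by
  rw [← Real.exp_neg]; congr 1; ring

lemma expQuotient_pos (hα : 0 < α) (ξ : ℝ) : 0 < expQuotient α ξ := by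
  unfold expQuotient
  split_ifs with h
  · positivity
  · rcases lt_or_gt_of_ne h with h | h
    · apply div_pos_of_neg_of_neg _ h
      rw [sub_neg, Real.one_lt_exp_iff]
      have := mul_pos (mul_pos two_pi_pos (neg_pos.mpr h)) hα
      linarith
    · apply div_pos _ h
      rw [sub_pos, Real.exp_lt_one_iff]
      have := mul_pos (mul_pos two_pi_pos h) hα
      linarith

/-- The logarithm of `(1 - e^{-2πξα}) / ξ`, with its limit value at `ξ = 0`. -/
noncomputable def logExpQuotient (α ξ : ℝ) : ℝ := log (expQuotient α ξ)

lemma two_pi_div_pos (hα : 0 < α) : 0 < 2 * π / α := by positivity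

lemma four_pi_mul_boseSine (hα : 0 < α) {ξ : ℝ} (hξ : ξ ≠ 0) :
    4 * π * boseSine (2 * π / α) ξ =
      2 * π * α / (exp (2 * π * α * ξ) - 1) + π * α - 1 / ξ := by
  have e1 : 4 * π ^ 2 / (2 * π / α) = 2 * π * α := by field_simp; ring
  have e2 : 2 * π ^ 2 / (2 * π / α) = π * α := by field_simp
  rw [boseSine_eq (two_pi_div_pos hα) hξ, e1, e2]

/-- The sine transform is, up to constants, the derivative of `logExpQuotient`; this ties the
singular integral to the elementary terms of the formula. -/
lemma hasDerivAt_logExpQuotient (hα : 0 < α) (ξ : ℝ) :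
    HasDerivAt (logExpQuotient α) (4 * π * boseSine (2 * π / α) ξ - π * α) ξ := by
  have hne : ∀ y : ℝ, y ≠ 0 →
      HasDerivAt (logExpQuotient α) (4 * π * boseSine (2 * π / α) y - π * α) y := by
    intro y hy
    have h1 : HasDerivAt (fun x : ℝ => -2 * π * x * α) (-2 * π * α) y := by
      simpa using ((hasDerivAt_id y).const_mul (-2 * π)).mul_const α
    have h2 := (h1.exp.const_sub 1).div (hasDerivAt_id y) hy
    have hpos := expQuotient_pos hα y
    have h0 : expQuotient α y = (1 - exp (-2 * π * y * α)) / y := by rw [expQuotient, if_neg hy]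
    have h3 := h2.log (by simpa [h0] using hpos.ne')
    have h4 : (fun x => log ((1 - exp (-2 * π * x * α)) / x)) =ᶠ[𝓝 y] logExpQuotient α := by
      filter_upwards [isOpen_ne.mem_nhds hy] with x hx
      rw [logExpQuotient, expQuotient, if_neg hx]
    convert! h4.hasDerivAt_iff.mp h3 using 1
    have hE : exp (2 * π * α * y) - 1 ≠ 0 := by
      rw [sub_ne_zero, Ne, Real.exp_eq_one_iff]
      positivity
    have hE' : exp (2 * π * α * y) ≠ 0 := (exp_pos _).ne'
    have hE2 : 1 - (exp (2 * π * α * y))⁻¹ ≠ 0 := by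
      intro h
      apply hE
      field_simp at h
      simpa using h
    rw [four_pi_mul_boseSine hα hy]
    simp only [exp_neg_form, id, Pi.div_apply]
    have hE3 : 1 - (exp (2 * π * α * y))⁻¹ = (exp (2 * π * α * y) - 1) / exp (2 * π * α * y) := by
      field_simp
    rw [hE3]
    field_simp
    ring
  rcases eq_or_ne ξ 0 with rfl | h
  · refine hasDerivAt_of_hasDerivAt_of_ne (fun y hy => hne y hy) ?_ ?_
    · refine ContinuousAt.log ?_ (expQuotient_pos hα 0).ne'
      rw [expQuotient_eq_dslope, continuousAt_dslope_same]
      fun_prop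
    · have := continuous_boseSine (two_pi_div_pos hα)
      exact (by fun_prop : Continuous _).continuousAt
  · exact hne ξ h

lemma bernoulliIntegrand_eq (hα : 0 < α) (t : ℝ) :
    bernoulliIntegrand α t = t * (4 * π * boseSine (2 * π / α) t - π * α) := by
  rcases eq_or_ne t 0 with rfl | h
  · simp [bernoulliIntegrand]
  · rw [four_pi_mul_boseSine hα h, bernoulliIntegrand, if_neg h]
    field_simp
    ring

lemma continuous_bernoulliIntegrand (hα : 0 < α) : Continuous (bernoulliIntegrand α) := by
  have := continuous_boseSine (two_pi_div_pos hα)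
  rw [funext (bernoulliIntegrand_eq hα)]
  fun_prop

lemma integral_bernoulliIntegrand (hα : 0 < α) (a b : ℝ) :
    ∫ t in a..b, bernoulliIntegrand α t =
      b * logExpQuotient α b - a * logExpQuotient α a - ∫ t in a..b, logExpQuotient α t := by
  have hc := continuous_boseSine (two_pi_div_pos hα)
  have h := intervalIntegral.integral_mul_deriv_eq_deriv_mul (a := a) (b := b)
    (fun t _ => hasDerivAt_id t) (fun t _ => hasDerivAt_logExpQuotient hα t)
    intervalIntegrable_const (Continuous.intervalIntegrable (by fun_prop) _ _)
  simp only [id, one_mul] at h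
  rw [← h]
  exact intervalIntegral.integral_congr fun t _ => bernoulliIntegrand_eq hα t

/-- The increment of the principal value is the error of the trapezoidal rule for `logExpQuotient`
on `[ξ, ξ + 1]`. -/
lemma sinePV_add_one_sub_eq (hα : 0 < α) (ξ : ℝ) :
    2 / π * (sinePV (2 * π / α) (ξ + 1) - sinePV (2 * π / α) ξ) =
      (logExpQuotient α ξ + logExpQuotient α (ξ + 1)) / 2 -
        ∫ t in ξ..(ξ + 1), logExpQuotient α t := by
  have hc := continuous_boseSine (two_pi_div_pos hα)
  have hu : ∀ r : ℝ, HasDerivAt (fun r : ℝ => 2 * r - 1) 2 r := by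
    intro r
    simpa using ((hasDerivAt_id r).const_mul 2).sub_const 1
  have hv : ∀ r : ℝ, HasDerivAt (fun r => logExpQuotient α (ξ + r))
      (4 * π * boseSine (2 * π / α) (ξ + r) - π * α) r := by
    intro r
    simpa using (hasDerivAt_logExpQuotient hα (ξ + r)).comp_const_add ξ r
  have h := intervalIntegral.integral_mul_deriv_eq_deriv_mul (a := 0) (b := 1)
    (fun r _ => hu r) (fun r _ => hv r) intervalIntegrable_const
    (Continuous.intervalIntegrable (by fun_prop) _ _)
  rw [intervalIntegral.integral_const_mul,
    intervalIntegral.integral_comp_add_left (fun t => logExpQuotient α t)] at h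
  have h2 : ∫ r in (0 : ℝ)..1, (2 * r - 1) * (4 * π * boseSine (2 * π / α) (ξ + r) - π * α) =
      4 * π * ∫ r in (0 : ℝ)..1, (2 * r - 1) * boseSine (2 * π / α) (ξ + r) := by
    have h3 : ∫ r in (0 : ℝ)..1, (2 * r - 1) = 0 := by
      rw [intervalIntegral.integral_sub (Continuous.intervalIntegrable (by fun_prop) _ _)
        intervalIntegrable_const, intervalIntegral.integral_const_mul, integral_id]
      norm_num
    have h4 : ∀ r : ℝ, (2 * r - 1) * (4 * π * boseSine (2 * π / α) (ξ + r) - π * α) =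
        4 * π * ((2 * r - 1) * boseSine (2 * π / α) (ξ + r)) - (2 * r - 1) * (π * α) := by
      intro r; ring
    simp_rw [h4]
    rw [intervalIntegral.integral_sub (Continuous.intervalIntegrable (by fun_prop) _ _)
        (Continuous.intervalIntegrable (by fun_prop) _ _), intervalIntegral.integral_const_mul,
      intervalIntegral.integral_mul_const, h3, zero_mul, sub_zero]
  rw [h2] at h
  rw [sinePV_add_one_sub (two_pi_div_pos hα)]
  have : 2 / π * (π ^ 2 * ∫ r in (0 : ℝ)..1, (2 * r - 1) * boseSine (2 * π / α) (ξ + r)) =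
      (4 * π * ∫ r in (0 : ℝ)..1, (2 * r - 1) * boseSine (2 * π / α) (ξ + r)) / 2 := by
    field_simp
    ring
  rw [this, h]
  norm_num
  ring

/-! ### Asymptotics of the elementary terms -/

/-- Stirling's formula along an arithmetic progression, from Stirling's formula for factorials and
Gauss's limit formula for `Γ`. -/
lemma tendsto_logGamma_sub_stirling {a : ℝ} (ha : 0 < a) :
    Tendsto (fun n : ℕ => log (Gamma (a + n + 1)) - (a + n + 1 / 2) * log (a + n) + (a + n)) atTop
      (𝓝 (log √(2 * π))) := by
  have hG := (GammaSeq_tendsto_Gamma a).log (Gamma_pos_of_pos ha).ne'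
  have hS := Stirling.tendsto_stirlingSeq_sqrt_pi.log (by positivity : √π ≠ 0)
  have hL : Tendsto (fun n : ℕ => (a + n + 1 / 2) * log (1 + a / n)) atTop (𝓝 a) := by
    have h1 := (Real.tendsto_mul_log_one_add_div_atTop a).comp tendsto_natCast_atTop_atTop
    have h2 : Tendsto (fun n : ℕ => (a + 1 / 2) * log (1 + a / n)) atTop
        (𝓝 ((a + 1 / 2) * log (1 + 0))) :=
      ((tendsto_const_nhds.add (tendsto_const_div_atTop_nhds_zero_nat a)).log
        (by norm_num)).const_mul _
    rw [add_zero, log_one, mul_zero] at h2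
    have h3 := h1.add h2
    rw [add_zero] at h3
    refine h3.congr fun n => ?_
    simp only [Function.comp]
    ring
  have hprod : ∀ n : ℕ, Gamma (a + n + 1) = Gamma a * ∏ j ∈ Finset.range (n + 1), (a + j) := by
    intro n
    induction n with
    | zero => simp [Gamma_add_one ha.ne', mul_comm]
    | succ n ih =>
      rw [Finset.prod_range_succ, ← mul_assoc, ← ih]
      push_cast
      rw [← add_assoc, Gamma_add_one (by positivity), mul_comm]
  have hlim := (((hG.const_sub (log (Gamma a))).add hS).sub hL).add_const (log √2 + a)
  have hval : log (Gamma a) - log (Gamma a) + log √π - a + (log √2 + a) = log √(2 * π) := by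
    rw [Real.sqrt_mul two_pos.le, Real.log_mul (by positivity) (by positivity)]
    ring
  rw [hval] at hlim
  refine hlim.congr' ?_
  filter_upwards [eventually_gt_atTop 0] with n hn
  have hn' : (0 : ℝ) < n := by exact_mod_cast hn
  have hp : 0 < ∏ j ∈ Finset.range (n + 1), (a + j) := Finset.prod_pos fun j _ => by positivity
  have hf : (0 : ℝ) < n.factorial := by exact_mod_cast n.factorial_pos
  rw [hprod, Real.GammaSeq, Stirling.stirlingSeq]
  have e1 : log (1 + a / n) = log (a + n) - log n := by
    rw [← Real.log_div (by positivity) hn'.ne']; congr 1; field_simp; ring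
  rw [e1, Real.log_div (by positivity) hp.ne', Real.log_div hf.ne' (by positivity),
    Real.log_mul (by positivity) hf.ne', Real.log_mul (Gamma_pos_of_pos ha).ne' hp.ne',
    Real.log_mul (by positivity) (by positivity), Real.log_rpow hn', Real.log_pow,
    Real.log_div hn'.ne' (by positivity), Real.log_exp, Real.sqrt_mul (by positivity),
    Real.log_mul (by positivity) (by positivity), Real.log_sqrt hn'.le]
  ring

lemma intervalIntegral_bernoulliIntegrand (hα : 0 < α) {x : ℝ} (hx : 0 ≤ x) :
    ∫ t in (0 : ℝ)..x, bernoulliIntegrand α t =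
      2 * π * α * (∫ t in (0 : ℝ)..x, t * bose (2 * π * α) t) - x := by
  have hi : IntervalIntegrable (fun t => t * bose (2 * π * α) t) volume 0 x := by
    rw [intervalIntegrable_iff, uIoc_of_le hx]
    exact (integrableOn_mul_bose (by positivity)).mono_set fun t ht => ht.1
  have h : ∫ t in (0 : ℝ)..x, bernoulliIntegrand α t =
      ∫ t in (0 : ℝ)..x, (2 * π * α * (t * bose (2 * π * α) t) - 1) := by
    refine intervalIntegral.integral_congr_ae ?_
    filter_upwards [Measure.ae_ne volume 0] with t ht _
    rw [bernoulliIntegrand, if_neg ht, bose]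
    ring
  rw [h, intervalIntegral.integral_sub (hi.const_mul _) intervalIntegrable_const,
    intervalIntegral.integral_const_mul]
  simp

lemma tendsto_intervalIntegral_bernoulliIntegrand_add (hα : 0 < α) :
    Tendsto (fun x => (∫ t in (0 : ℝ)..x, bernoulliIntegrand α t) + x) atTop
      (𝓝 (π / (12 * α))) := by
  have hc : 0 < 2 * π * α := by positivity
  have h := (intervalIntegral_tendsto_integral_Ioi 0 (integrableOn_mul_bose hc)
    tendsto_id).const_mul (2 * π * α)
  rw [integral_mul_bose hc] at h
  have e : 2 * π * α * (π ^ 2 / (6 * (2 * π * α) ^ 2)) = π / (12 * α) := by field_simp; norm_num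
  rw [e] at h
  refine h.congr' ?_
  filter_upwards [eventually_ge_atTop 0] with x hx
  rw [intervalIntegral_bernoulliIntegrand hα hx]
  simp

lemma logExpQuotient_of_pos (hα : 0 < α) {x : ℝ} (hx : 0 < x) :
    logExpQuotient α x = log (1 - exp (-2 * π * x * α)) - log x := by
  have : 0 < 1 - exp (-2 * π * x * α) := by
    rw [sub_pos, Real.exp_lt_one_iff]
    have := mul_pos (mul_pos two_pi_pos hx) hα
    linarith
  rw [logExpQuotient, expQuotient, if_neg hx.ne', Real.log_div this.ne' hx.ne']

lemma abs_log_one_sub_exp_le (hα : 0 < α) {x : ℝ} (hx : 0 < x) :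
    |log (1 - exp (-2 * π * x * α))| ≤ bose (2 * π * α) x := by
  have hc : 0 < 2 * π * α := by positivity
  have hE := exp_mul_sub_one_pos hc hx
  have hE0 := exp_pos (2 * π * α * x)
  have h1 : 1 - exp (-2 * π * x * α) = (exp (2 * π * α * x) - 1) / exp (2 * π * α * x) := by
    rw [exp_neg_form]; field_simp
  have h2 : log (1 - exp (-2 * π * x * α)) ≤ 0 := by
    rw [h1]
    refine Real.log_nonpos (by positivity) ?_
    rw [div_le_one hE0]
    linarith
  rw [abs_of_nonpos h2, h1, ← Real.log_inv, inv_div]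
  refine (Real.log_le_sub_one_of_pos (by positivity)).trans (le_of_eq ?_)
  rw [bose]
  field_simp
  ring

lemma tendsto_mul_log_one_sub_exp (hα : 0 < α) :
    Tendsto (fun x => (x + 1 / 2) * log (1 - exp (-2 * π * x * α))) atTop (𝓝 0) := by
  have hc : 0 < 2 * π * α := by positivity
  have h1 : Tendsto (fun x : ℝ => 4 / (2 * π * α) ^ 2 / x) atTop (𝓝 0) :=
    tendsto_id.const_div_atTop _
  refine squeeze_zero_norm' ?_ h1
  filter_upwards [eventually_ge_atTop 1] with x hx
  have hx0 : 0 < x := by linarith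
  rw [norm_mul, Real.norm_eq_abs, Real.norm_eq_abs, abs_of_pos (by positivity : 0 < x + 1 / 2)]
  calc (x + 1 / 2) * |log (1 - exp (-2 * π * x * α))|
      ≤ (2 * x) * ((Nat.factorial 2 : ℕ) / (2 * π * α * x) ^ 2) := by
        have := (abs_log_one_sub_exp_le hα hx0).trans (bose_le hc hx0 two_ne_zero)
        gcongr
        linarith
    _ = _ := by simp [Nat.factorial]; field_simp; norm_num

/-! ### The infinite product and the formula -/

/-- The logarithm of the `n`-th factor of `(x; q)_∞` with `x = e^{-2π(1+ξ)α}` and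
`q = e^{-2πα}`. -/
noncomputable def logProductTerm (α ξ : ℝ) (n : ℕ) : ℝ :=
  log (1 - exp (-2 * π * (1 + ξ + n) * α))

/-- The logarithm of `(x; q)_∞` as a series. -/
noncomputable def logProduct (α ξ : ℝ) : ℝ := ∑' n, logProductTerm α ξ n

lemma mul_pow_eq_exp (α ξ : ℝ) (n : ℕ) :
    exp (-2 * π * (1 + ξ) * α) * exp (-2 * π * α) ^ n = exp (-2 * π * (1 + ξ + n) * α) := by
  rw [← Real.exp_nat_mul, ← Real.exp_add]
  congr 1
  ring

lemma exp_lt_one_of_pos (hα : 0 < α) {y : ℝ} (hy : 0 < y) : exp (-2 * π * y * α) < 1 := by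
  rw [Real.exp_lt_one_iff]
  have := mul_pos (mul_pos two_pi_pos hy) hα
  linarith

lemma summable_neg_mul_pow (hα : 0 < α) (ξ : ℝ) :
    Summable fun n : ℕ => -(exp (-2 * π * (1 + ξ) * α) * exp (-2 * π * α) ^ n) := by
  refine ((summable_geometric_of_lt_one (exp_pos _).le ?_).mul_left _).neg
  simpa using exp_lt_one_of_pos hα one_pos

lemma summable_logProductTerm (hα : 0 < α) (ξ : ℝ) : Summable (logProductTerm α ξ) := by
  refine (Real.summable_log_one_add_of_summable (summable_neg_mul_pow hα ξ)).congr fun n => ?_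
  rw [logProductTerm, ← mul_pow_eq_exp, sub_eq_add_neg]

lemma logProduct_add_one (hα : 0 < α) (ξ : ℝ) :
    logProduct α (ξ + 1) = logProduct α ξ - log (1 - exp (-2 * π * (ξ + 1) * α)) := by
  have h := (summable_logProductTerm hα ξ).tsum_eq_zero_add
  rw [logProduct, logProduct, h, logProductTerm, Nat.cast_zero, add_zero, add_comm 1 ξ,
    add_sub_cancel_left]
  refine tsum_congr fun n => ?_
  rw [logProductTerm, logProductTerm]
  push_cast
  ring_nf

lemma tendsto_logProduct (α ξ : ℝ) :
    Tendsto (fun N : ℕ => logProduct α (ξ + N)) atTop (𝓝 0) := by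
  refine (_root_.tendsto_sum_nat_add (logProductTerm α ξ)).congr fun N => tsum_congr fun n => ?_
  rw [logProductTerm, logProductTerm]
  push_cast
  ring_nf

lemma multipliable_and_log_qPochhammerInf (hα : 0 < α) {ξ : ℝ} (hξ : -1 < ξ) :
    Multipliable (fun n : ℕ => 1 - exp (-2 * π * (1 + ξ) * α) * exp (-2 * π * α) ^ n) ∧
    qPochhammerInf (exp (-2 * π * (1 + ξ) * α)) (exp (-2 * π * α)) = exp (logProduct α ξ) := by
  constructor
  · exact (Real.multipliable_one_add_of_summable (summable_neg_mul_pow hα ξ)).congr fun n => by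
      rw [sub_eq_add_neg]
  · rw [qPochhammerInf, logProduct]
    unfold logProductTerm
    rw [Real.rexp_tsum_eq_tprod (f := fun n : ℕ => 1 - exp (-2 * π * (1 + ξ + n) * α))
      (fun n => ?_) (summable_logProductTerm hα ξ)]
    · exact tprod_congr fun n => by rw [mul_pow_eq_exp]
    · exact sub_pos.mpr (exp_lt_one_of_pos hα (by linarith [n.cast_nonneg (α := ℝ)]))

lemma sinTerm_eq_sineTerm (α ξ t : ℝ) : sinTerm α ξ t = sineTerm (2 * π / α) ξ t := by
  ext n
  rw [sinTerm, sineTerm, bose, show 2 * n * ξ * π * t = 2 * π * (n * ξ) * t by ring,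
    show 2 * n * π * t / α = 2 * π / α * (n * t) by ring, div_div, mul_one_div]
  congr 1
  ring

lemma cosTerm_eq (α ξ : ℝ) :
    cosTerm α ξ = fun n : ℕ+ => bose (2 * π / α) n / n * cos (2 * π * (n * ξ)) := by
  ext n
  rw [cosTerm, bose, show 2 * n * π * ξ = 2 * π * (n * ξ) by ring,
    show 2 * n * π / α = 2 * π / α * n by ring, div_div, one_div_mul_eq_div]
  congr 1
  ring

lemma hasCauchyPV_singularIntegrand (hα : 0 < α) (ξ : ℝ) :
    HasCauchyPV (singularIntegrand α ξ) (sinePV (2 * π / α) ξ) := by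
  have hβ := two_pi_div_pos hα
  obtain ⟨h1, h2, h3⟩ := truncatedIntegral_sineTerm hβ ξ
  have e : singularIntegrand α ξ =
      fun t => (∑' n, sineTerm (2 * π / α) ξ t n) * (1 / (1 - t ^ 2)) := by
    ext t
    rw [singularIntegrand, sinTerm_eq_sineTerm]
  rw [e]
  refine ⟨?_, h1, h2, h3⟩
  have hsub : Ioo (0 : ℝ) 1 ∪ Ioi 1 ⊆ Ioi 0 :=
    union_subset (fun t ht => ht.1) (Ioi_subset_Ioi zero_le_one)
  refine ((continuousOn_tsum_sineTerm hβ ξ).mono hsub).mul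
    (ContinuousOn.div continuousOn_const (by fun_prop) ?_)
  rintro t (ht | ht)
  · have : t ^ 2 < 1 := by nlinarith [ht.1, ht.2]
    linarith
  · have ht : 1 < t := ht
    have : 1 < t ^ 2 := by nlinarith
    linarith

/-- The part of the difference between the two sides of the formula that is not visibly
`1`-periodic in `ξ`: the cosine series and the constants are left out. -/
noncomputable def defect (α ξ : ℝ) : ℝ :=
  logProduct α ξ - (log (√(2 * π) / Gamma (ξ + 1)) - (ξ + 1 / 2) * logExpQuotient α ξ +
    ∫ t in (0 : ℝ)..ξ, bernoulliIntegrand α t) + 2 / π * sinePV (2 * π / α) ξ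

lemma defect_add_one (hα : 0 < α) {ξ : ℝ} (hξ : -1 < ξ) : defect α (ξ + 1) = defect α ξ := by
  have hpos : 0 < ξ + 1 := by linarith
  have hi := fun a b => (continuous_bernoulliIntegrand hα).intervalIntegrable (μ := volume) a b
  have h1 := sinePV_add_one_sub_eq hα ξ
  have h2 := integral_bernoulliIntegrand hα ξ (ξ + 1)
  have h3 := logExpQuotient_of_pos hα hpos
  have h4 := logProduct_add_one hα ξ
  have h5 := intervalIntegral.integral_add_adjacent_intervals (hi 0 ξ) (hi ξ (ξ + 1))
  have h6 : log (Gamma (ξ + 1 + 1)) = log (ξ + 1) + log (Gamma (ξ + 1)) := by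
    rw [Gamma_add_one hpos.ne', Real.log_mul hpos.ne' (Gamma_pos_of_pos hpos).ne']
  have hs : √(2 * π) ≠ 0 := by positivity
  rw [defect, defect, Real.log_div hs (Gamma_pos_of_pos hpos).ne',
    Real.log_div hs (Gamma_pos_of_pos (by linarith)).ne', h6, h4, ← h5, h2]
  linear_combination h1 + h3

lemma tendsto_defect (hα : 0 < α) {ξ : ℝ} (hξ : -1 < ξ) :
    Tendsto (fun N : ℕ => defect α (ξ + N)) atTop
      (𝓝 (-(π / (12 * α)) + π / 12 * α - ∑' n, cosTerm α ξ n)) := by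
  have hpos : 0 < ξ + 1 := by linarith
  have hlim : Tendsto (fun N : ℕ => ξ + (N : ℝ)) atTop atTop :=
    tendsto_atTop_add_const_left _ ξ tendsto_natCast_atTop_atTop
  have hΓ : Tendsto (fun N : ℕ => log (Gamma (ξ + N + 1)) - (ξ + N + 1 / 2) * log (ξ + N) + (ξ + N))
      atTop (𝓝 (log √(2 * π))) := by
    rw [← tendsto_add_atTop_iff_nat 1]
    refine (tendsto_logGamma_sub_stirling hpos).congr fun n => ?_
    rw [show ξ + ((n + 1 : ℕ) : ℝ) = ξ + 1 + n by push_cast; ring]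
  have h := ((((tendsto_logProduct α ξ).add hΓ).sub_const (log √(2 * π))).add
    ((tendsto_mul_log_one_sub_exp hα).comp hlim)).sub
    ((tendsto_intervalIntegral_bernoulliIntegrand_add hα).comp hlim) |>.add
    ((tendsto_sinePV (two_pi_div_pos hα) ξ).const_mul (2 / π))
  have hval : 0 + log √(2 * π) - log √(2 * π) + 0 - π / (12 * α) +
      2 / π * (π ^ 2 / 6 * (π / (2 * (2 * π / α))) -
        π / 2 * ∑' n : ℕ+, bose (2 * π / α) n / n * cos (2 * π * (n * ξ))) =
      -(π / (12 * α)) + π / 12 * α - ∑' n, cosTerm α ξ n := by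
    rw [cosTerm_eq]
    generalize ∑' n : ℕ+, bose (2 * π / α) n / n * cos (2 * π * (n * ξ)) = S
    field_simp
    ring
  rw [hval] at h
  refine h.congr' ?_
  filter_upwards [hlim.eventually_gt_atTop 0] with N hN
  have hs : √(2 * π) ≠ 0 := by positivity
  simp only [Function.comp]
  rw [defect, Real.log_div hs (Gamma_pos_of_pos (by linarith)).ne', logExpQuotient_of_pos hα hN]
  ring

lemma defect_eq (hα : 0 < α) {ξ : ℝ} (hξ : -1 < ξ) :
    defect α ξ = -(π / (12 * α)) + π / 12 * α - ∑' n, cosTerm α ξ n := by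
  have hper : ∀ N : ℕ, defect α (ξ + N) = defect α ξ := by
    intro N
    induction N with
    | zero => simp
    | succ N ih =>
      rw [← ih, ← defect_add_one hα (by linarith [N.cast_nonneg (α := ℝ)] : -1 < ξ + N)]
      push_cast
      rw [add_assoc]
  refine tendsto_nhds_unique ?_ (tendsto_defect hα hξ)
  simp_rw [hper]
  exact tendsto_const_nhds

end QPochhammerAsymptotics

open QPochhammerAsymptotics in
theorem theorem2p1 (α ξ q x : ℝ) (hα : 0 < α) (hξ : -1 < ξ)
    (hq : q = Real.exp (-2 * Real.pi * α))
    (hx : x = Real.exp (-2 * Real.pi * (1 + ξ) * α)) :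
    -- all the expressions in the formula are meaningful
    (Multipliable (fun n : ℕ => 1 - x * q ^ n) ∧ 0 < qPochhammerInf x q) ∧
    IntervalIntegrable (bernoulliIntegrand α) volume 0 ξ ∧
    Summable (cosTerm α ξ) ∧
    (∀ t : ℝ, 0 < t → Summable (sinTerm α ξ t)) ∧
    HasCauchyPV (singularIntegrand α ξ) (cauchyPV (singularIntegrand α ξ)) ∧
    -- the formula
    Real.log (qPochhammerInf x q) =
      -(Real.pi / (12 * α)) + Real.log (Real.sqrt (2 * Real.pi) / Real.Gamma (ξ + 1))
        + Real.pi / 12 * α - (ξ + 1 / 2) * Real.log (expQuotient α ξ)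
        + (∫ t in (0 : ℝ)..ξ, bernoulliIntegrand α t)
        + almostModularTerm α ξ := by
  subst hq hx
  have hβ := two_pi_div_pos hα
  obtain ⟨hm, hlog⟩ := multipliable_and_log_qPochhammerInf hα hξ
  have hPV := hasCauchyPV_singularIntegrand hα ξ
  have hval : cauchyPV (singularIntegrand α ξ) = sinePV (2 * Real.pi / α) ξ :=
    hPV.tendsto.limUnder_eq
  refine ⟨⟨hm, ?_⟩, (continuous_bernoulliIntegrand hα).intervalIntegrable _ _, ?_, fun t ht => ?_,
    ?_, ?_⟩
  · rw [hlog]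
    exact Real.exp_pos _
  · rw [cosTerm_eq]
    exact summable_windowTerm hβ fun n => Real.abs_cos_le_one _
  · rw [sinTerm_eq_sineTerm]
    exact summable_sineTerm hβ ξ ht
  · rwa [hval]
  · have h := defect_eq hα hξ
    rw [defect, logExpQuotient] at h
    rw [hlog, Real.log_exp, almostModularTerm, hval]
    linarith
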